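/- Let $(X_{ij})_{i,j\ge 1}$ be i.i.d. complex random variables, let $\alpha\in(0,2)$, and assume (H2): for some constant $c_0>0$, $\mathbb P(|X_{11}|\ge t)\sim c_0\,t^{-\alpha}$ as $t\to\infty$. For $n\ge 1$ put $a_n=\inf\{a>0:\ n\,\mathbb P(|X_{11}|\ge a)\le 1\}$ and let $A=A_n$ be the random $n\times n$ matrix with entries $A_{ij}=a_n^{-1}X_{ij}$ (if $a_n=0$, which happens for at most finitely many $n$, put $a_n^{-1}=0$). Let $0<\gamma\le\alpha/4$ and $z\in\mathbb C$, and let $R$ be the first row of $a_n(A-zI)$. Then there is a constant $c>0$, not depending on $n$, such that for every $n\ge 1$ and every $d$-dimensional linear subspace $W$ of $\mathbb C^n$ with codimension $n-d\ge n^{1-\gamma}$ there is an event $E$ (which may depend on $n$ and $W$), belonging to the $\sigma$-algebra generated by $R$, with $$\mathbb E\big[\mathrm{dist}(R,W)^{-2}\,;\,E\big]\le c\,(n-d)^{-2/\alpha}\qquad\text{and}\qquad \mathbb P(E^c)\le c\,n^{-(1-2\gamma)/\alpha}.$$ Here $\mathrm{dist}$ is the distance for the standard Hermitian norm of $\mathbb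 C^n$, $0^{-2}=+\infty$, and $\mathbb E[Y;E]=\mathbb E[Y\mathbf 1_E]$ with $\infty\cdot 0=0$. -/

import Mathlib

open MeasureTheory ProbabilityTheory Filter Asymptotics

noncomputable section

namespace HeavyTailed

variable {Ω : Type*} [MeasurableSpace Ω]

/-- `(X i j)` is an infinite array of i.i.d. complex random variables on `(Ω, μ)`.
Rows and columns are numbered from `0`, so that `X 0 0` is the first entry. -/
structure IsIIDArray (μ : Measure Ω) (X : ℕ → ℕ → Ω → ℂ) : Prop where
  measurable : ∀ i j, Measurable (X i j)
  indep : iIndepFun (fun p : ℕ × ℕ => X p.1 p.2) μ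
  identDistrib : ∀ i j, IdentDistrib (X i j) (X 0 0) μ μ

/-- The tail hypothesis: `P(|Y| ≥ t) ∼ c₀ t ^ (-α)` as `t → ∞`, for some `c₀ > 0`. -/
def PowerTail (μ : Measure Ω) (Y : Ω → ℂ) (α : ℝ) : Prop :=
  ∃ c₀ : ℝ, 0 < c₀ ∧
    (fun t : ℝ => μ.real {ω | t ≤ ‖Y ω‖}) ~[atTop] (fun t : ℝ => c₀ * t ^ (-α))

/-- The normalizing constant `a_n = inf {a > 0 : n P(|Y| ≥ a) ≤ 1}`. -/
def scale (μ : Measure Ω) (Y : Ω → ℂ) (n : ℕ) : ℝ :=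
  sInf {a : ℝ | 0 < a ∧ (n : ℝ) * μ.real {ω | a ≤ ‖Y ω‖} ≤ 1}

/-- The random `n × n` matrix `A` with entries `A i j = a_n⁻¹ X i j`. -/
def rescaledMatrix (μ : Measure Ω) (X : ℕ → ℕ → Ω → ℂ) (n : ℕ) (ω : Ω) :
    Matrix (Fin n) (Fin n) ℂ :=
  Matrix.of fun i j => ((scale μ (X 0 0) n : ℝ) : ℂ)⁻¹ * X i j ω

/-- The first row of the `n × n` matrix `a_n (A - z I)`, for `n ≥ 1`, as a random vector
of the Hermitian space `ℂ ^ n`. -/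
def firstRow (μ : Measure Ω) (X : ℕ → ℕ → Ω → ℂ) (z : ℂ) (n : ℕ) (hn : 0 < n) (ω : Ω) :
    EuclideanSpace ℂ (Fin n) :=
  WithLp.toLp 2
    ((((scale μ (X 0 0) n : ℝ) : ℂ) •
      (rescaledMatrix μ X n ω - z • (1 : Matrix (Fin n) (Fin n) ℂ))).row ⟨0, hn⟩)

end HeavyTailed

end

namespace HeavyTailed

open scoped ENNReal NNReal

/-! The distance from `R` to `W` is at least `‖P R‖`, where `P` is the orthogonal projection onto
`Wᗮ`, of complex dimension m. Up to a deterministic shift, `R` has independent heavy-tailed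
coordinates, so everything rests on a small ball estimate for `P R` at the scale m^(1/α).

That estimate is Fourier analytic. With an independent copy R' of `R`, the square of the probability
that ‖P R‖ ≤ r is at most e² E exp(-‖P(R - iR')‖²/(2r²)). Writing this Gaussian weight as an average
of characters over a standard Gaussian vector G of `Wᗮ` bounds it by the mean of ∏ |φ(G_j/r)|
|φ(iG_j/r)|, where φ is the characteristic function of one entry (`sq_measure_norm_perpProj_le`).
The shift disappears in absolute value. The tail of the entries gives |φ(ξ)φ(iξ)| ≤ exp(-c|ξ|²
L^(2-α)) when |ξ|L ≤ 1 and L is large (`exists_norm_charFun_mul_le`); the two directions ξ and iξ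
together remove any concern about laws carried by a real line. Finally, with high probability the
coordinates of G of modulus at most M carry energy at least m/4
(`exists_stdGaussian_truncated_energy`), so L = r/M gives decay exp(-c m r^(-2) (r/M)^(2-α)).

For r = t m^(1/α) and M a small negative power of t, all errors are O(t^q), for any fixed q, as long
as n^(-1/12) ≤ t ≤ 1 (`exists_measure_norm_perpProj_le`). The event asks that ‖P R‖ exceed about
n^(-1/12) m^(1/α): on it, summation over dyadic t bounds the inverse second moment, while its
complement is one more small ball. -/

/-! ### Standard Gaussian vectors: small norms and moments of linear forms. -/

lemma integral_exp_neg_sq_half_gaussianReal :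
    ∫ x, Real.exp (-(x ^ 2 / 2)) ∂(gaussianReal 0 1) = (√2)⁻¹ := by
  rw [integral_gaussianReal_eq_integral_smul one_ne_zero]
  have h : ∀ x : ℝ, gaussianPDFReal 0 1 x • Real.exp (-(x ^ 2 / 2))
      = (√(2 * Real.pi))⁻¹ * Real.exp (-1 * x ^ 2) := by
    intro x
    simp only [gaussianPDFReal, smul_eq_mul, NNReal.coe_one, mul_one, sub_zero]
    rw [mul_assoc, ← Real.exp_add]
    congr 2
    ring
  simp_rw [h]
  rw [integral_const_mul, integral_gaussian]
  rw [Real.sqrt_mul (by norm_num), div_one]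
  have : √Real.pi ≠ 0 := (Real.sqrt_pos.2 Real.pi_pos).ne'
  field_simp

lemma integral_exp_neg_norm_sq_half_stdGaussian (V : Type*) [NormedAddCommGroup V]
    [InnerProductSpace ℝ V] [FiniteDimensional ℝ V] [MeasurableSpace V] [BorelSpace V] :
    ∫ G : V, Real.exp (-(‖G‖ ^ 2 / 2)) ∂(stdGaussian V)
      = ((√2)⁻¹) ^ (Module.finrank ℝ V) := by
  rw [stdGaussian, integral_map (Measurable.aemeasurable (by fun_prop))
    (Measurable.aestronglyMeasurable (by fun_prop))]
  have h : ∀ x : Fin (Module.finrank ℝ V) → ℝ,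
      Real.exp (-(‖∑ i, x i • stdOrthonormalBasis ℝ V i‖ ^ 2 / 2))
        = ∏ i, Real.exp (-(x i ^ 2 / 2)) := by
    intro x
    rw [← Real.exp_sum, ← (stdOrthonormalBasis ℝ V).sum_sq_inner_right]
    congr 1
    rw [Finset.sum_neg_distrib, Finset.sum_div]
    congr 1
    refine Finset.sum_congr rfl fun i _ => ?_
    rw [inner_sum, Finset.sum_eq_single i]
    · simp [inner_smul_right]
    · intro j _ hj
      rw [inner_smul_right, (stdOrthonormalBasis ℝ V).inner_eq_zero hj.symm, mul_zero]
    · simp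
  simp_rw [h]
  rw [integral_fintype_prod_eq_prod (f := fun _ x => Real.exp (-(x ^ 2 / 2)))]
  simp [integral_exp_neg_sq_half_gaussianReal]

/-- Chernoff bound: in real dimension D, the mean of exp(-‖G‖²/2) is 2^(-D/2), and e < 4 makes this
at most exp(-D/4). -/
lemma stdGaussian_norm_sq_lt_le (V : Type*) [NormedAddCommGroup V]
    [InnerProductSpace ℝ V] [FiniteDimensional ℝ V] [MeasurableSpace V] [BorelSpace V] :
    (stdGaussian V).real {G : V | ‖G‖ ^ 2 < Module.finrank ℝ V / 4}
      ≤ Real.exp (-(Module.finrank ℝ V / 8)) := by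
  set D : ℝ := (Module.finrank ℝ V : ℝ) with hD
  have hint : Integrable (fun G : V => Real.exp (-(‖G‖ ^ 2 / 2))) (stdGaussian V) := by
    refine Integrable.of_bound (C := 1) (by fun_prop) (ae_of_all _ fun G => ?_)
    rw [Real.norm_eq_abs, abs_of_pos (Real.exp_pos _), Real.exp_le_one_iff]
    have := sq_nonneg ‖G‖
    linarith
  have h1 := mul_meas_ge_le_integral_of_nonneg (μ := stdGaussian V)
    (ae_of_all _ fun G : V => (Real.exp_pos (-(‖G‖ ^ 2 / 2))).le) hint (Real.exp (-(D / 8)))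
  rw [integral_exp_neg_norm_sq_half_stdGaussian] at h1
  have h2 : (stdGaussian V).real {G : V | ‖G‖ ^ 2 < D / 4}
      ≤ (stdGaussian V).real {G : V | Real.exp (-(D / 8)) ≤ Real.exp (-(‖G‖ ^ 2 / 2))} := by
    refine measureReal_mono fun G hG => ?_
    simp only [Set.mem_ofPred_eq, Real.exp_le_exp] at hG ⊢
    linarith
  have h3 : ((√2)⁻¹) ^ (Module.finrank ℝ V) ≤ Real.exp (-(D / 4)) := by
    have h4 : (√2)⁻¹ ≤ Real.exp (-(1 / 4)) := by
      rw [Real.exp_neg]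
      refine inv_anti₀ (Real.exp_pos _) (Real.le_sqrt_of_sq_le ?_)
      rw [← Real.exp_nat_mul]
      have h5 : Real.exp ((2 : ℕ) * (1 / 4)) ^ 2 < 2 ^ 2 := by
        rw [← Real.exp_nat_mul]
        have := Real.exp_one_lt_d9
        norm_num at this ⊢
        linarith
      exact (lt_of_pow_lt_pow_left₀ 2 (by norm_num) h5).le
    calc ((√2)⁻¹) ^ (Module.finrank ℝ V) ≤ Real.exp (-(1 / 4)) ^ (Module.finrank ℝ V) :=
          pow_le_pow_left₀ (by positivity) h4 _
      _ = Real.exp (-(D / 4)) := by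
          rw [← Real.exp_nat_mul]; congr 1; rw [hD]; ring
  have h6 : Real.exp (-(D / 4)) = Real.exp (-(D / 8)) * Real.exp (-(D / 8)) := by
    rw [← Real.exp_add]; congr 1; ring
  have h7 := h1.trans (h3.trans h6.le)
  exact h2.trans (le_of_mul_le_mul_left h7 (Real.exp_pos _))

lemma map_inner_stdGaussian {V : Type*} [NormedAddCommGroup V]
    [InnerProductSpace ℝ V] [FiniteDimensional ℝ V] [MeasurableSpace V] [BorelSpace V] (a : V) :
    (stdGaussian V).map (fun G => inner ℝ a G) = (gaussianReal 0 1).map (fun x => ‖a‖ * x) := by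
  apply Measure.ext_of_charFun
  ext t
  rw [charFun_apply, integral_map (by fun_prop) (by fun_prop), gaussianReal_map_const_mul,
    charFun_gaussianReal]
  have h := charFun_stdGaussian (t • a)
  rw [charFun_apply] at h
  simp only [inner_smul_right] at h
  simp only [RCLike.inner_apply, conj_trivial, real_inner_comm _ a]
  rw [h]
  congr 1
  rw [← Complex.ofReal_pow, norm_smul, mul_pow, Real.norm_eq_abs, sq_abs]
  simp
  ring

/-- The `k`-th absolute moment of a standard real Gaussian variable. -/
noncomputable def gaussianMoment (k : ℕ) : ℝ≥0∞ := ∫⁻ x, ‖x‖ₑ ^ k ∂(gaussianReal 0 1)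

lemma gaussianMoment_lt_top (k : ℕ) : gaussianMoment k < ∞ := by
  have h := (memLp_id_gaussianReal (μ := 0) (v := 1) (k : ℝ≥0)).integrable_norm_pow'
  have h2 := h.2
  unfold gaussianMoment
  simpa [HasFiniteIntegral] using h2

lemma lintegral_inner_pow_stdGaussian {V : Type*} [NormedAddCommGroup V]
    [InnerProductSpace ℝ V] [FiniteDimensional ℝ V] [MeasurableSpace V] [BorelSpace V]
    (a : V) (k : ℕ) :
    ∫⁻ G, ‖inner ℝ a G‖ₑ ^ k ∂(stdGaussian V) = ‖a‖ₑ ^ k * gaussianMoment k := by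
  have h : ∫⁻ G, ‖inner ℝ a G‖ₑ ^ k ∂(stdGaussian V)
      = ∫⁻ y, ‖y‖ₑ ^ k ∂((stdGaussian V).map (fun G => inner ℝ a G)) := by
    rw [lintegral_map (by fun_prop) (by fun_prop)]
  rw [h, map_inner_stdGaussian, lintegral_map (by fun_prop) (by fun_prop), gaussianMoment,
    ← lintegral_const_mul _ (by fun_prop)]
  simp [enorm_mul, mul_pow]

/-! ### Coordinates of a complex Gaussian vector and their truncated energy. -/

section Complex

attribute [local instance] InnerProductSpace.complexToReal

variable {V : Type*} [NormedAddCommGroup V] [InnerProductSpace ℂ V] [FiniteDimensional ℂ V]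
  [MeasurableSpace V] [BorelSpace V]

lemma lintegral_complex_inner_pow_stdGaussian (a : V) (ha : ‖a‖ ≤ 1) (k : ℕ) :
    ∫⁻ G, ‖inner ℂ a G‖ₑ ^ k ∂(stdGaussian V) ≤ 2 * 2 ^ k * gaussianMoment k := by
  have hre : ∀ G : V, (inner ℂ a G).re = inner ℝ a G := fun G => rfl
  have him : ∀ G : V, (inner ℂ a G).im = inner ℝ (Complex.I • a) G := by
    intro G
    change _ = (inner ℂ (Complex.I • a) G).re
    rw [inner_smul_left]
    simp
  have hpt : ∀ G : V, ‖inner ℂ a G‖ₑ ^ k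
      ≤ 2 ^ k * (‖inner ℝ a G‖ₑ ^ k + ‖inner ℝ (Complex.I • a) G‖ₑ ^ k) := by
    intro G
    have h1 : ‖inner ℂ a G‖ ≤ ‖inner ℝ a G‖ + ‖inner ℝ (Complex.I • a) G‖ := by
      rw [← hre, ← him]
      exact Complex.norm_le_abs_re_add_abs_im _
    have h2 : ‖inner ℂ a G‖ₑ ≤ ‖inner ℝ a G‖ₑ + ‖inner ℝ (Complex.I • a) G‖ₑ := by
      simp only [← ofReal_norm]
      rw [← ENNReal.ofReal_add (norm_nonneg _) (norm_nonneg _)]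
      exact ENNReal.ofReal_le_ofReal h1
    refine (pow_le_pow_left' h2 k).trans ?_
    rcases le_total ‖inner ℝ a G‖ₑ ‖inner ℝ (Complex.I • a) G‖ₑ with h | h
    · calc _ ≤ (2 * ‖inner ℝ (Complex.I • a) G‖ₑ) ^ k := by
            gcongr; rw [two_mul]; gcongr
        _ ≤ _ := by rw [mul_pow]; gcongr; exact le_add_self
    · calc _ ≤ (2 * ‖inner ℝ a G‖ₑ) ^ k := by
            gcongr; rw [two_mul]; gcongr
        _ ≤ _ := by rw [mul_pow]; gcongr; exact le_self_add
  refine (lintegral_mono hpt).trans ?_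
  rw [lintegral_const_mul _ (by fun_prop), lintegral_add_left (by fun_prop),
    lintegral_inner_pow_stdGaussian, lintegral_inner_pow_stdGaussian]
  have h1 : ‖a‖ₑ ^ k ≤ 1 := by
    refine pow_le_one' ?_ k
    rw [← ofReal_norm]
    exact ENNReal.ofReal_le_one.2 ha
  have h2 : ‖Complex.I • a‖ₑ ^ k ≤ 1 := by
    refine pow_le_one' ?_ k
    rw [← ofReal_norm, norm_smul, Complex.norm_I, one_mul]
    exact ENNReal.ofReal_le_one.2 ha
  calc _ ≤ 2 ^ k * (1 * gaussianMoment k + 1 * gaussianMoment k) := by gcongr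
    _ = _ := by ring

/-- Moments of a quartic form in Gaussian coordinates. -/
lemma lintegral_sum_pow_four_pow_le {ι : Type*} [Fintype ι] (a : ι → V) (ha : ∀ j, ‖a j‖ ≤ 1)
    (p : ℕ) :
    ∫⁻ G, ENNReal.ofReal ((∑ j, ‖inner ℂ (a j) G‖ ^ 4) ^ p) ∂(stdGaussian V)
      ≤ ENNReal.ofReal ((∑ j, ‖a j‖ ^ 2) ^ p) * (2 * 2 ^ (4 * p) * gaussianMoment (4 * p)) := by
  set m : ℝ := ∑ j, ‖a j‖ ^ 2 with hm
  have hm0 : 0 ≤ m := Finset.sum_nonneg fun j _ => sq_nonneg _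
  rcases hm0.eq_or_lt with hz | hmpos
  · have haj : ∀ j, a j = 0 := by
      intro j
      have := (Finset.sum_eq_zero_iff_of_nonneg (fun j _ => sq_nonneg ‖a j‖)).1 hz.symm j
        (Finset.mem_univ j)
      simpa using this
    rcases Nat.eq_zero_or_pos p with rfl | hp
    · simp [gaussianMoment]
    · simp [haj, hp.ne']
  set b : ι → V := fun j => ((‖a j‖⁻¹ : ℝ) : ℂ) • a j with hb
  have hb1 : ∀ j, ‖b j‖ ≤ 1 := by
    intro j
    simp only [hb, norm_smul, Complex.norm_real, norm_inv, norm_norm]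
    exact inv_mul_le_one
  have hab : ∀ j G, ‖inner ℂ (a j) G‖ = ‖a j‖ * ‖inner ℂ (b j) G‖ := by
    intro j G
    by_cases h : a j = 0
    · simp [h]
    · have : ‖a j‖ ≠ 0 := by simpa using h
      simp only [hb, inner_smul_left, norm_mul, Complex.conj_ofReal, Complex.norm_real, norm_inv,
        norm_norm]
      field_simp
  -- The weights `‖a j‖ ^ 2 / m` sum to one, so Jensen's inequality moves the power p inside the
  -- sum. The bound then depends on the `a j` only through m, not on their number.
  have hpt : ∀ G : V, (∑ j, ‖inner ℂ (a j) G‖ ^ 4) ^ p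
      ≤ m ^ p * ∑ j, (‖a j‖ ^ 2 / m) * ‖inner ℂ (b j) G‖ ^ (4 * p) := by
    intro G
    have h1 : ∑ j, ‖inner ℂ (a j) G‖ ^ 4 ≤ m * ∑ j, (‖a j‖ ^ 2 / m) * ‖inner ℂ (b j) G‖ ^ 4 := by
      rw [Finset.mul_sum]
      refine Finset.sum_le_sum fun j _ => ?_
      rw [hab, mul_pow]
      have h2 : ‖a j‖ ^ 4 ≤ ‖a j‖ ^ 2 :=
        pow_le_pow_of_le_one (norm_nonneg _) (ha j) (by norm_num)
      calc _ ≤ ‖a j‖ ^ 2 * ‖inner ℂ (b j) G‖ ^ 4 := by gcongr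
        _ = _ := by field_simp
    refine (pow_le_pow_left₀ (by positivity) h1 p).trans ?_
    rw [mul_pow]
    gcongr
    have h3 := Real.pow_arith_mean_le_arith_mean_pow Finset.univ (fun j => ‖a j‖ ^ 2 / m)
      (fun j => ‖inner ℂ (b j) G‖ ^ 4) (fun j _ => by positivity)
      (by rw [← Finset.sum_div, ← hm, div_self hmpos.ne']) (fun j _ => by positivity) p
    simpa only [← pow_mul] using h3
  calc ∫⁻ G, ENNReal.ofReal ((∑ j, ‖inner ℂ (a j) G‖ ^ 4) ^ p) ∂(stdGaussian V)
      ≤ ∫⁻ G, ENNReal.ofReal (m ^ p) * ∑ j, ENNReal.ofReal (‖a j‖ ^ 2 / m)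
          * ‖inner ℂ (b j) G‖ₑ ^ (4 * p) ∂(stdGaussian V) := by
        refine lintegral_mono fun G => (ENNReal.ofReal_le_ofReal (hpt G)).trans_eq ?_
        rw [ENNReal.ofReal_mul (by positivity), ENNReal.ofReal_sum_of_nonneg
          (fun j _ => by positivity)]
        congr 1
        refine Finset.sum_congr rfl fun j _ => ?_
        rw [ENNReal.ofReal_mul (by positivity), ENNReal.ofReal_pow (norm_nonneg _), ofReal_norm]
    _ = ENNReal.ofReal (m ^ p) * ∑ j, ENNReal.ofReal (‖a j‖ ^ 2 / m)
          * ∫⁻ G, ‖inner ℂ (b j) G‖ₑ ^ (4 * p) ∂(stdGaussian V) := by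
        rw [lintegral_const_mul _ (by fun_prop), lintegral_finsetSum _ (by fun_prop)]
        congr 1
        refine Finset.sum_congr rfl fun j _ => ?_
        rw [lintegral_const_mul _ (by fun_prop)]
    _ ≤ ENNReal.ofReal (m ^ p) * ∑ j, ENNReal.ofReal (‖a j‖ ^ 2 / m)
          * (2 * 2 ^ (4 * p) * gaussianMoment (4 * p)) := by
        gcongr with j
        exact lintegral_complex_inner_pow_stdGaussian _ (hb1 j) _
    _ = _ := by
        rw [← Finset.sum_mul, ← ENNReal.ofReal_sum_of_nonneg (fun j _ => by positivity),
          ← Finset.sum_div, ← hm, div_self hmpos.ne']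
        simp

/-- The truncated energy of the coordinates of a Gaussian vector is at least a quarter of the
dimension, except on an event of small probability. -/
lemma exists_stdGaussian_truncated_energy (p : ℕ) :
    ∃ C : ℝ, 0 < C ∧ ∀ (V : Type) [NormedAddCommGroup V] [InnerProductSpace ℂ V]
      [FiniteDimensional ℂ V] [MeasurableSpace V] [BorelSpace V] (n : ℕ) (a : Fin n → V),
      (∀ j, ‖a j‖ ≤ 1) → (∑ j, ‖a j‖ ^ 2 = Module.finrank ℂ V) →
      (∀ G : V, ∑ j, ‖inner ℂ (a j) G‖ ^ 2 = ‖G‖ ^ 2) → 0 < Module.finrank ℂ V →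
      ∀ M : ℝ, 0 < M →
      (stdGaussian V).real {G : V | ∑ j with ‖inner ℂ (a j) G‖ ≤ M, ‖inner ℂ (a j) G‖ ^ 2
          < (Module.finrank ℂ V : ℝ) / 4}
        ≤ C * M⁻¹ ^ (2 * p) + Real.exp (-((Module.finrank ℂ V : ℝ) / 4)) := by
  set K : ℝ≥0∞ := 2 * 2 ^ (4 * p) * gaussianMoment (4 * p) with hK
  have hKtop : K ≠ ∞ := ENNReal.mul_ne_top (by finiteness) (gaussianMoment_lt_top _).ne
  refine ⟨4 ^ p * K.toReal + 1, by positivity, ?_⟩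
  intro V _ _ _ _ _ n a ha hsum henergy hpos M hM
  set m : ℝ := (Module.finrank ℂ V : ℝ) with hm
  have hmpos : 0 < m := Nat.cast_pos.2 hpos
  -- The real dimension is 2m. If ‖G‖² ≥ m/2 and the fourth powers sum to less than M²m/4, the
  -- coordinates above M carry less than m/4, and the others keep at least m/4.
  have hsub : {G : V | ∑ j with ‖inner ℂ (a j) G‖ ≤ M, ‖inner ℂ (a j) G‖ ^ 2 < m / 4}
      ⊆ {G : V | ‖G‖ ^ 2 < Module.finrank ℝ V / 4} ∪
        {G : V | (M ^ 2 * (m / 4)) ^ p ≤ (∑ j, ‖inner ℂ (a j) G‖ ^ 4) ^ p} := by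
    intro G hG
    simp only [Set.mem_union, Set.mem_ofPred_eq] at hG ⊢
    by_contra! hcon
    obtain ⟨h1, h2⟩ := hcon
    have h3 : ∑ j, ‖inner ℂ (a j) G‖ ^ 4 < M ^ 2 * (m / 4) :=
      lt_of_pow_lt_pow_left₀ p (by positivity) h2
    have h4 : (Module.finrank ℝ V : ℝ) = 2 * m := by
      rw [finrank_real_of_complex]; push_cast; rfl
    rw [h4, ← henergy G, ← Finset.sum_filter_add_sum_filter_not Finset.univ
      (fun j => ‖inner ℂ (a j) G‖ ≤ M)] at h1
    have h5 : M ^ 2 * ∑ j with ¬ ‖inner ℂ (a j) G‖ ≤ M, ‖inner ℂ (a j) G‖ ^ 2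
        ≤ ∑ j, ‖inner ℂ (a j) G‖ ^ 4 := by
      rw [Finset.mul_sum]
      refine (Finset.sum_le_sum (g := fun j => ‖inner ℂ (a j) G‖ ^ 4) fun j hj => ?_).trans
        (Finset.sum_le_sum_of_subset_of_nonneg (Finset.filter_subset _ _)
          fun j _ _ => by positivity)
      simp only [Finset.mem_filter, Finset.mem_univ, true_and, not_le] at hj
      calc _ ≤ ‖inner ℂ (a j) G‖ ^ 2 * ‖inner ℂ (a j) G‖ ^ 2 := by gcongr
        _ = _ := by ring
    have h6 := lt_of_mul_lt_mul_left (h5.trans_lt h3) (by positivity)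
    linarith
  have hmarkov : (stdGaussian V).real
      {G : V | (M ^ 2 * (m / 4)) ^ p ≤ (∑ j, ‖inner ℂ (a j) G‖ ^ 4) ^ p}
      ≤ 4 ^ p * K.toReal * M⁻¹ ^ (2 * p) := by
    have h1 := mul_meas_ge_le_lintegral₀ (μ := stdGaussian V)
      (f := fun G => ENNReal.ofReal ((∑ j, ‖inner ℂ (a j) G‖ ^ 4) ^ p)) (by fun_prop)
      (ENNReal.ofReal ((M ^ 2 * (m / 4)) ^ p))
    have h2 := h1.trans (lintegral_sum_pow_four_pow_le a ha p)
    rw [hsum, ← hK] at h2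
    have h3 : {G : V | (M ^ 2 * (m / 4)) ^ p ≤ (∑ j, ‖inner ℂ (a j) G‖ ^ 4) ^ p}
        = {G : V | ENNReal.ofReal ((M ^ 2 * (m / 4)) ^ p)
          ≤ ENNReal.ofReal ((∑ j, ‖inner ℂ (a j) G‖ ^ 4) ^ p)} := by
      ext G
      simp only [Set.mem_ofPred_eq]
      rw [ENNReal.ofReal_le_ofReal_iff (by positivity)]
    rw [h3, Measure.real]
    have h4 := ENNReal.toReal_mono (by finiteness) h2
    rw [ENNReal.toReal_mul, ENNReal.toReal_mul, ENNReal.toReal_ofReal (by positivity),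
      ENNReal.toReal_ofReal (by positivity)] at h4
    have h5 : (0:ℝ) < (M ^ 2 * (m / 4)) ^ p := by positivity
    refine (le_of_mul_le_mul_left (h4.trans_eq ?_) h5)
    rw [mul_pow, div_pow, inv_pow, pow_mul]
    field_simp
  calc _ ≤ _ := measureReal_mono hsub
    _ ≤ _ := measureReal_union_le _ _
    _ ≤ Real.exp (-(Module.finrank ℝ V / 8)) + 4 ^ p * K.toReal * M⁻¹ ^ (2 * p) :=
        add_le_add (stdGaussian_norm_sq_lt_le V) hmarkov
    _ ≤ _ := by
        have h4 : (Module.finrank ℝ V : ℝ) / 8 = m / 4 := by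
          rw [finrank_real_of_complex]; push_cast; rw [hm]; ring
        rw [h4]
        have : 0 ≤ M⁻¹ ^ (2 * p) := by positivity
        linarith

end Complex

/-! ### Decay of the characteristic function of a heavy-tailed law. -/

/-- Symmetrization: the squared modulus is the characteristic function of the difference of two
independent copies. -/
lemma one_sub_norm_charFun_sq (ρ : Measure ℂ) [IsProbabilityMeasure ρ] (ξ : ℂ) :
    1 - ‖charFun ρ ξ‖ ^ 2
      = ∫ q : ℂ × ℂ, (1 - Real.cos (inner ℝ (q.1 - q.2) ξ)) ∂(ρ.prod ρ) := by
  have hint : Integrable (fun q : ℂ × ℂ => Real.cos (inner ℝ (q.1 - q.2) ξ)) (ρ.prod ρ) :=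
    Integrable.of_bound (C := 1) (by fun_prop) (ae_of_all _ fun q => Real.abs_cos_le_one _)
  rw [integral_sub (integrable_const _) hint]
  simp only [integral_const, probReal_univ, one_smul, sub_right_inj]
  have h1 : ((‖charFun ρ ξ‖ ^ 2 : ℝ) : ℂ)
      = ∫ q : ℂ × ℂ, Complex.exp ((inner ℝ (q.1 - q.2) ξ : ℝ) * Complex.I) ∂(ρ.prod ρ) := by
    push_cast
    rw [← Complex.mul_conj', ← charFun_neg, charFun_apply, charFun_apply, ← integral_prod_mul]
    congr 1
    ext q
    rw [← Complex.exp_add]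
    congr 1
    rw [inner_sub_left, inner_neg_right]
    push_cast
    ring
  have hint2 : Integrable (fun q : ℂ × ℂ =>
      Complex.exp ((inner ℝ (q.1 - q.2) ξ : ℝ) * Complex.I)) (ρ.prod ρ) :=
    Integrable.of_bound (C := 1) (by fun_prop)
      (ae_of_all _ fun q => (Complex.norm_exp_ofReal_mul_I _).le)
  have h2 := congrArg Complex.re h1
  rw [Complex.ofReal_re] at h2
  rw [h2]
  rw [← Complex.reCLM_apply, ← Complex.reCLM.integral_comp_comm hint2]
  simp only [Complex.reCLM_apply, Complex.exp_ofReal_mul_I_re]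

lemma norm_sq_mul_norm_sq_eq_inner (u ξ : ℂ) :
    (inner ℝ u ξ : ℝ) ^ 2 + (inner ℝ u (Complex.I * ξ) : ℝ) ^ 2 = ‖u‖ ^ 2 * ‖ξ‖ ^ 2 := by
  rw [← Complex.normSq_eq_norm_sq, ← Complex.normSq_eq_norm_sq]
  simp only [Complex.inner, Complex.normSq_apply, Complex.mul_re, Complex.conj_re, Complex.conj_im,
    Complex.mul_im, Complex.I_re, Complex.I_im]
  ring

/-- A single direction could be orthogonal to the symmetrized variable u, but the squares of its
pairings with ξ and iξ always add up to ‖u‖²‖ξ‖². The quadratic bound on the cosine, valid up to π,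
turns this into a lower bound on `S`. -/
lemma norm_charFun_mul_norm_charFun_I_le (ρ : Measure ℂ) [IsProbabilityMeasure ρ] (ξ : ℂ)
    {ℓ L : ℝ} (hℓ : 0 ≤ ℓ) (hξ : ‖ξ‖ * L ≤ 1) {S : Set (ℂ × ℂ)} (hS : MeasurableSet S)
    (hSℓ : ∀ q ∈ S, ℓ ≤ ‖q.1 - q.2‖) (hSL : ∀ q ∈ S, ‖q.1 - q.2‖ ≤ L) :
    ‖charFun ρ ξ‖ * ‖charFun ρ (Complex.I * ξ)‖
      ≤ Real.exp (-((1 / Real.pi ^ 2) * ‖ξ‖ ^ 2 * ℓ ^ 2 * (ρ.prod ρ).real S)) := by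
  set δ : ℝ := (2 / Real.pi ^ 2) * ‖ξ‖ ^ 2 * ℓ ^ 2 * (ρ.prod ρ).real S with hδ
  set h : ℂ → ℝ := fun η => 1 - ‖charFun ρ η‖ ^ 2 with hh
  have hint : ∀ η : ℂ, Integrable (fun q : ℂ × ℂ => 1 - Real.cos (inner ℝ (q.1 - q.2) η))
      (ρ.prod ρ) := fun η => (integrable_const _).sub
    (Integrable.of_bound (C := 1) (by fun_prop) (ae_of_all _ fun q => Real.abs_cos_le_one _))
  have hsum : δ ≤ h ξ + h (Complex.I * ξ) := by
    simp only [hh]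
    rw [one_sub_norm_charFun_sq, one_sub_norm_charFun_sq, ← integral_add (hint _) (hint _)]
    have h1 : δ = ∫ q, S.indicator (fun _ => (2 / Real.pi ^ 2) * ‖ξ‖ ^ 2 * ℓ ^ 2) q
        ∂(ρ.prod ρ) := by
      rw [integral_indicator_const _ hS, smul_eq_mul, hδ]
      ring
    rw [h1]
    refine integral_mono ((integrable_const _).indicator hS) ((hint _).add (hint _)) fun q => ?_
    by_cases hq : q ∈ S
    · rw [Set.indicator_of_mem hq]
      have hu : ‖q.1 - q.2‖ * ‖ξ‖ ≤ Real.pi := by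
        calc _ ≤ L * ‖ξ‖ := by gcongr; exact hSL q hq
          _ ≤ 1 := by rw [mul_comm]; exact hξ
          _ ≤ Real.pi := by linarith [Real.pi_gt_three]
      have hb1 := Real.cos_le_one_sub_mul_cos_sq ((abs_real_inner_le_norm (q.1 - q.2) ξ).trans hu)
      have hb2 := Real.cos_le_one_sub_mul_cos_sq
        ((abs_real_inner_le_norm (q.1 - q.2) (Complex.I * ξ)).trans
          (by rw [norm_mul, Complex.norm_I, one_mul]; exact hu))
      have hb3 := norm_sq_mul_norm_sq_eq_inner (q.1 - q.2) ξ
      have hb4 : ℓ ^ 2 * ‖ξ‖ ^ 2 ≤ ‖q.1 - q.2‖ ^ 2 * ‖ξ‖ ^ 2 := by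
        gcongr
        exact hSℓ q hq
      have hpi : 0 ≤ 2 / Real.pi ^ 2 := by positivity
      calc (2 / Real.pi ^ 2) * ‖ξ‖ ^ 2 * ℓ ^ 2 = 2 / Real.pi ^ 2 * (ℓ ^ 2 * ‖ξ‖ ^ 2) := by ring
        _ ≤ 2 / Real.pi ^ 2 * (‖q.1 - q.2‖ ^ 2 * ‖ξ‖ ^ 2) := by gcongr
        _ = 2 / Real.pi ^ 2 * (inner ℝ (q.1 - q.2) ξ) ^ 2
            + 2 / Real.pi ^ 2 * (inner ℝ (q.1 - q.2) (Complex.I * ξ)) ^ 2 := by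
            rw [← hb3]; ring
        _ ≤ _ := by linarith
    · rw [Set.indicator_of_notMem hq]
      have h1 := Real.cos_le_one (inner ℝ (q.1 - q.2) ξ)
      have h2 := Real.cos_le_one (inner ℝ (q.1 - q.2) (Complex.I * ξ))
      linarith
  have hexp : ∀ η, ‖charFun ρ η‖ ^ 2 ≤ Real.exp (-h η) := fun η => by
    have := Real.add_one_le_exp (-h η)
    simp only [hh] at this ⊢
    linarith
  refine le_of_sq_le_sq ?_ (Real.exp_pos _).le
  calc (‖charFun ρ ξ‖ * ‖charFun ρ (Complex.I * ξ)‖) ^ 2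
      = ‖charFun ρ ξ‖ ^ 2 * ‖charFun ρ (Complex.I * ξ)‖ ^ 2 := by ring
    _ ≤ Real.exp (-h ξ) * Real.exp (-h (Complex.I * ξ)) :=
        mul_le_mul (hexp _) (hexp _) (by positivity) (by positivity)
    _ = Real.exp (-(h ξ + h (Complex.I * ξ))) := by rw [← Real.exp_add]; congr 1; ring
    _ ≤ Real.exp (-δ) := by gcongr
    _ = _ := by rw [← Real.exp_nat_mul]; congr 1; rw [hδ]; push_cast; ring

lemma tendsto_tail_zero {α c₀ : ℝ} (hα : 0 < α) {f : ℝ → ℝ}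
    (hf : f ~[atTop] fun t => c₀ * t ^ (-α)) : Tendsto f atTop (nhds 0) :=
  hf.symm.tendsto_nhds (by simpa using (tendsto_rpow_neg_atTop hα).const_mul c₀)

lemma eventually_tail_bounds {α c₀ : ℝ} (hc₀ : 0 < c₀) {f : ℝ → ℝ}
    (hf : f ~[atTop] fun t => c₀ * t ^ (-α)) :
    ∀ᶠ t in atTop, c₀ / 2 * t ^ (-α) ≤ f t ∧ f t ≤ 2 * c₀ * t ^ (-α) := by
  filter_upwards [hf.isLittleO.bound (show (0:ℝ) < 1 / 2 by norm_num), eventually_gt_atTop 0]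
    with t ht ht0
  have h1 : 0 < c₀ * t ^ (-α) := mul_pos hc₀ (Real.rpow_pos_of_pos ht0 _)
  simp only [Pi.sub_apply, Real.norm_eq_abs, abs_of_pos h1] at ht
  rw [abs_le] at ht
  constructor <;> nlinarith [ht.1, ht.2]

/-- Decay of the characteristic function of a heavy-tailed complex law, averaged over two
orthogonal directions. -/
lemma exists_norm_charFun_mul_le {α c₀ : ℝ} (hα : 0 < α) (hc₀ : 0 < c₀) (ρ : Measure ℂ)
    [IsProbabilityMeasure ρ]
    (hf : (fun t : ℝ => ρ.real {x | t ≤ ‖x‖}) ~[atTop] fun t => c₀ * t ^ (-α)) :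
    ∃ c L₀ : ℝ, 0 < c ∧ 0 < L₀ ∧ ∀ L, L₀ ≤ L → ∀ ξ : ℂ, ‖ξ‖ * L ≤ 1 →
      ‖charFun ρ ξ‖ * ‖charFun ρ (Complex.I * ξ)‖
        ≤ Real.exp (-(c * ‖ξ‖ ^ 2 * L ^ (2 - α))) := by
  -- The tail is only known up to factors 1/2 and 2. This `K` makes the lower bound at L/K equal to
  -- 3·2^α c₀ L^(-α), against an upper bound 2·2^α c₀ L^(-α) at L/2, so the annulus between them has
  -- mass of order L^(-α).
  set K : ℝ := 2 * 6 ^ (1 / α) with hK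
  have hK2 : 2 < K := by
    have : (1:ℝ) < 6 ^ (1 / α) := Real.one_lt_rpow (by norm_num) (by positivity)
    linarith
  have hKα : K ^ α = 2 ^ α * 6 := by
    rw [hK, Real.mul_rpow (by norm_num) (by positivity), ← Real.rpow_mul (by norm_num),
      one_div_mul_cancel hα.ne', Real.rpow_one]
  obtain ⟨T, hT⟩ := eventually_atTop.1 (eventually_tail_bounds hc₀ hf)
  obtain ⟨B, hB⟩ := (((tendsto_tail_zero hα hf).eventually_lt_const
    (show (0:ℝ) < 1 / 2 by norm_num)).and (eventually_gt_atTop 0)).exists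
  obtain ⟨hB, hB0⟩ := hB
  set c : ℝ := (1 / Real.pi ^ 2) * (1 / (2 * K)) ^ 2 * (c₀ * 2 ^ α * (1 / 2)) with hc
  refine ⟨c, max (K * |T|) (2 * K * B), by positivity, lt_max_of_lt_right (by positivity), ?_⟩
  intro L hL ξ hξ
  have hL1 : K * |T| ≤ L := (le_max_left _ _).trans hL
  have hL2 : 2 * K * B ≤ L := (le_max_right _ _).trans hL
  have hLpos : 0 < L := lt_of_lt_of_le (by positivity) hL2
  have hBL : B ≤ L / (2 * K) := by rw [le_div_iff₀ (by positivity)]; linarith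
  have hKL : T ≤ L / K := by
    rw [le_div_iff₀ (by positivity)]; nlinarith [le_abs_self T]
  have hLK : L / K ≤ L / 2 := by gcongr
  have hLKK : L / K = L / (2 * K) + L / (2 * K) := by field_simp; norm_num
  have hLK4 : L / (2 * K) ≤ L / 2 := by
    gcongr; linarith
  -- One copy lies in the annulus and the other in a fixed ball of mass at least 1/2, so that their
  -- difference has modulus between L/(2K) and L.
  set S : Set (ℂ × ℂ) := {x : ℂ | L / K ≤ ‖x‖ ∧ ‖x‖ < L / 2} ×ˢ {y : ℂ | ‖y‖ < B} with hSdef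
  have hm1 : ∀ t : ℝ, MeasurableSet {x : ℂ | t ≤ ‖x‖} := fun t =>
    measurableSet_le measurable_const measurable_norm
  have hm2 : ∀ t : ℝ, MeasurableSet {x : ℂ | ‖x‖ < t} := fun t =>
    measurableSet_lt measurable_norm measurable_const
  have hS : MeasurableSet S := ((hm1 _).inter (hm2 _)).prod (hm2 _)
  have hmem : ∀ q ∈ S, L / K ≤ ‖q.1‖ ∧ ‖q.1‖ < L / 2 ∧ ‖q.2‖ < B := by
    rintro q ⟨⟨h1, h2⟩, h3⟩
    exact ⟨h1, h2, h3⟩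
  have hmain := norm_charFun_mul_norm_charFun_I_le ρ ξ (ℓ := L / (2 * K)) (by positivity) hξ hS
    (fun q hq => by
      obtain ⟨h1, h2, h3⟩ := hmem q hq
      have := norm_sub_norm_le q.1 q.2
      linarith)
    (fun q hq => by
      obtain ⟨h1, h2, h3⟩ := hmem q hq
      have := norm_sub_le q.1 q.2
      linarith)
  refine hmain.trans (Real.exp_le_exp.2 (neg_le_neg ?_))
  have hS1 : c₀ * 2 ^ α * L ^ (-α) ≤ ρ.real {x : ℂ | L / K ≤ ‖x‖ ∧ ‖x‖ < L / 2} := by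
    have heq : {x : ℂ | L / K ≤ ‖x‖ ∧ ‖x‖ < L / 2}
        = {x : ℂ | L / K ≤ ‖x‖} \ {x : ℂ | L / 2 ≤ ‖x‖} := by
      ext x; simp
    have hsub : {x : ℂ | L / 2 ≤ ‖x‖} ⊆ {x : ℂ | L / K ≤ ‖x‖} := fun x hx => hLK.trans hx
    rw [heq, measureReal_sdiff hsub (hm1 _)]
    have h1 := (hT (L / K) hKL).1
    have h2 := (hT (L / 2) (hKL.trans hLK)).2
    have h3 : ∀ b : ℝ, 0 < b → (L / b) ^ (-α) = b ^ α * L ^ (-α) := fun b hb => by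
      rw [Real.div_rpow hLpos.le hb.le, Real.rpow_neg hb.le, div_inv_eq_mul, mul_comm]
    rw [h3 _ (by positivity), hKα] at h1
    rw [h3 _ (by positivity)] at h2
    nlinarith
  have hS2 : 1 / 2 ≤ ρ.real {y : ℂ | ‖y‖ < B} := by
    have heq : {y : ℂ | ‖y‖ < B} = {y : ℂ | B ≤ ‖y‖}ᶜ := by ext x; simp
    rw [heq, probReal_compl_eq_one_sub (hm1 _)]
    linarith
  have hS3 : (c₀ * 2 ^ α * L ^ (-α)) * (1 / 2) ≤ (ρ.prod ρ).real S := by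
    rw [hSdef, measureReal_prod_prod]
    gcongr
  have hLexp : L ^ (2 - α) = L ^ 2 * L ^ (-α) := by
    rw [sub_eq_add_neg, Real.rpow_add hLpos, Real.rpow_two]
  calc c * ‖ξ‖ ^ 2 * L ^ (2 - α)
      = (1 / Real.pi ^ 2) * ‖ξ‖ ^ 2 * (L / (2 * K)) ^ 2
        * ((c₀ * 2 ^ α * L ^ (-α)) * (1 / 2)) := by
        rw [hLexp, hc]; ring
    _ ≤ _ := by gcongr

/-! ### Projection onto the orthogonal complement of the subspace. -/

section Projection

variable {n : ℕ} (W : Submodule ℂ (EuclideanSpace ℂ (Fin n)))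

/-- The orthogonal projection of `ℂ ^ n` onto the orthogonal complement of `W`. -/
noncomputable def perpProj : EuclideanSpace ℂ (Fin n) →L[ℂ] Wᗮ := Wᗮ.orthogonalProjectionOnto

lemma inner_perpProj (G : Wᗮ) (x : EuclideanSpace ℂ (Fin n)) :
    inner ℂ G (perpProj W x) = inner ℂ (G : EuclideanSpace ℂ (Fin n)) x :=
  Submodule.inner_orthogonalProjectionOnto_eq_of_mem_left G x

lemma norm_perpProj_le (x : EuclideanSpace ℂ (Fin n)) : ‖perpProj W x‖ ≤ ‖x‖ :=
  Submodule.norm_orthogonalProjectionOnto_apply_le _ x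

lemma norm_perpProj_le_infEDist (x : EuclideanSpace ℂ (Fin n)) :
    ENNReal.ofReal ‖perpProj W x‖
      ≤ Metric.infEDist x (W : Set (EuclideanSpace ℂ (Fin n))) := by
  rw [Metric.le_infEDist]
  intro w hw
  rw [edist_dist, dist_eq_norm]
  refine ENNReal.ofReal_le_ofReal ?_
  have h : perpProj W w = 0 := Submodule.orthogonalProjectionOnto_orthogonal_apply_eq_zero hw
  calc ‖perpProj W x‖ = ‖perpProj W (x - w)‖ := by rw [map_sub, h, sub_zero]
    _ ≤ ‖x - w‖ := norm_perpProj_le W _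

/-- The projection of the `j`-th standard basis vector onto the orthogonal complement of `W`. -/
noncomputable def perpBasis (j : Fin n) : Wᗮ := perpProj W (EuclideanSpace.basisFun (Fin n) ℂ j)

lemma norm_perpBasis_le (j : Fin n) : ‖perpBasis W j‖ ≤ 1 :=
  (norm_perpProj_le W _).trans_eq ((EuclideanSpace.basisFun (Fin n) ℂ).norm_eq_one j)

lemma norm_inner_perpBasis (G : Wᗮ) (j : Fin n) :
    ‖inner ℂ (perpBasis W j) G‖ = ‖(G : EuclideanSpace ℂ (Fin n)) j‖ := by
  rw [norm_inner_symm, perpBasis, inner_perpProj, norm_inner_symm]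
  simp [EuclideanSpace.inner_single_left]

lemma sum_norm_inner_perpBasis_sq (G : Wᗮ) :
    ∑ j, ‖inner ℂ (perpBasis W j) G‖ ^ 2 = ‖G‖ ^ 2 := by
  simp_rw [norm_inner_perpBasis]
  rw [← EuclideanSpace.norm_sq_eq, Submodule.coe_norm]

/-- The trace of the projection, computed by exchanging two sums of squared coordinates. -/
lemma sum_norm_perpBasis_sq : ∑ j, ‖perpBasis W j‖ ^ 2 = Module.finrank ℂ Wᗮ := by
  simp_rw [← (stdOrthonormalBasis ℂ Wᗮ).sum_sq_norm_inner_right (perpBasis W _)]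
  rw [Finset.sum_comm]
  simp_rw [norm_inner_symm _ (perpBasis W _), sum_norm_inner_perpBasis_sq]
  simp

end Projection

/-! ### Small ball probabilities for the projected row. -/

section SmallBall

attribute [local instance] InnerProductSpace.complexToReal

variable {n : ℕ}

/-- The characteristic function of a law on `ℂ ^ n`, identified with a real Euclidean space. -/
noncomputable def rowCharFun (ν : Measure (EuclideanSpace ℂ (Fin n)))
    (g : EuclideanSpace ℂ (Fin n)) : ℂ :=
  ∫ x, Complex.exp ((inner ℂ g x).re * Complex.I) ∂ν

/-- Gaussian linearization: the exponential of a square becomes an average of characters, which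
factor over independent coordinates. -/
lemma exp_neg_norm_sq_half_eq_integral {V : Type*} [NormedAddCommGroup V] [InnerProductSpace ℂ V]
    [FiniteDimensional ℂ V] [MeasurableSpace V] [BorelSpace V] (u : V) :
    ((Real.exp (-(‖u‖ ^ 2 / 2)) : ℝ) : ℂ)
      = ∫ G : V, Complex.exp ((inner ℂ G u).re * Complex.I) ∂(stdGaussian V) := by
  have h := charFun_stdGaussian u
  rw [charFun_apply] at h
  rw [Complex.ofReal_exp]
  refine Eq.trans ?_ h.symm
  congr 1
  push_cast
  ring

/-- Fourier bound for the probability that a random vector is close to a subspace. -/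
lemma sq_measure_norm_perpProj_le (W : Submodule ℂ (EuclideanSpace ℂ (Fin n)))
    (ν : Measure (EuclideanSpace ℂ (Fin n))) [IsProbabilityMeasure ν] {r : ℝ} (hr : 0 < r) :
    (ν.real {x | ‖perpProj W x‖ ≤ r}) ^ 2
      ≤ Real.exp 2 * ∫ G : Wᗮ, ‖rowCharFun ν (((r⁻¹ : ℝ) : ℂ) • (G : EuclideanSpace ℂ (Fin n)))‖
          * ‖rowCharFun ν (Complex.I • ((r⁻¹ : ℝ) : ℂ) • (G : EuclideanSpace ℂ (Fin n)))‖
          ∂(stdGaussian Wᗮ) := by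
  set H := EuclideanSpace ℂ (Fin n) with hH
  set A : Set H := {x | ‖perpProj W x‖ ≤ r} with hA
  have hAm : MeasurableSet A := measurableSet_le (by fun_prop) measurable_const
  -- The factor i on the second copy places its characteristic function at iG, which gives the
  -- product over two orthogonal directions. On A × A the vector `u` has norm at most 2, whence the
  -- constant e².
  set u : H × H → Wᗮ := fun q => ((r⁻¹ : ℝ) : ℂ) • perpProj W (q.1 - Complex.I • q.2) with hu
  have huc : Continuous u := by fun_prop
  set F : H × H → Wᗮ → ℂ := fun q G => Complex.exp ((inner ℂ G (u q)).re * Complex.I) with hF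
  have hFc : Continuous (Function.uncurry F) := by
    simp only [hF, Function.uncurry_def]
    fun_prop
  have hFint : Integrable (Function.uncurry F) ((ν.prod ν).prod (stdGaussian Wᗮ)) :=
    Integrable.of_bound (C := 1) hFc.aestronglyMeasurable
      (ae_of_all _ fun q => (Complex.norm_exp_ofReal_mul_I _).le)
  have hexpint : Integrable (fun q => Real.exp (-(‖u q‖ ^ 2 / 2))) (ν.prod ν) := by
    refine Integrable.of_bound (C := 1) (by fun_prop) (ae_of_all _ fun q => ?_)
    rw [Real.norm_eq_abs, abs_of_pos (Real.exp_pos _), Real.exp_le_one_iff]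
    have := sq_nonneg ‖u q‖
    linarith
  have h1 : (ν.real A) ^ 2 ≤ Real.exp 2 * ∫ q, Real.exp (-(‖u q‖ ^ 2 / 2)) ∂(ν.prod ν) := by
    rw [sq, ← measureReal_prod_prod, ← integral_indicator_one (hAm.prod hAm),
      ← integral_const_mul]
    refine integral_mono ((integrable_const _).indicator (hAm.prod hAm))
      (hexpint.const_mul _) fun q => ?_
    by_cases hq : q ∈ A ×ˢ A
    · rw [Set.indicator_of_mem hq]
      obtain ⟨hq1, hq2⟩ := hq
      have hq1 : ‖perpProj W q.1‖ ≤ r := hq1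
      have hq2 : ‖perpProj W q.2‖ ≤ r := hq2
      have h2 : ‖u q‖ ≤ 2 := by
        simp only [hu, norm_smul, Complex.norm_real, norm_inv, Real.norm_eq_abs, abs_of_pos hr]
        rw [inv_mul_le_iff₀ hr, map_sub, map_smul]
        refine (norm_sub_le _ _).trans ?_
        rw [norm_smul, Complex.norm_I, one_mul]
        linarith
      have h3 : ‖u q‖ ^ 2 ≤ 2 ^ 2 := pow_le_pow_left₀ (norm_nonneg _) h2 2
      simp only [Pi.one_apply]
      rw [← Real.exp_add]
      exact Real.one_le_exp (by linarith)
    · rw [Set.indicator_of_notMem hq]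
      positivity
  refine h1.trans (mul_le_mul_of_nonneg_left ?_ (Real.exp_pos _).le)
  have h2 : ((∫ q, Real.exp (-(‖u q‖ ^ 2 / 2)) ∂(ν.prod ν) : ℝ) : ℂ)
      = ∫ G : Wᗮ, ∫ q, F q G ∂(ν.prod ν) ∂(stdGaussian Wᗮ) := by
    rw [← integral_complex_ofReal]
    simp_rw [exp_neg_norm_sq_half_eq_integral]
    exact integral_integral_swap hFint
  have h3 : ∀ G : Wᗮ, ∫ q, F q G ∂(ν.prod ν)
      = rowCharFun ν (((r⁻¹ : ℝ) : ℂ) • (G : H))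
        * rowCharFun ν (Complex.I • ((r⁻¹ : ℝ) : ℂ) • (G : H)) := by
    intro G
    rw [rowCharFun, rowCharFun, ← integral_prod_mul]
    congr 1
    ext q
    simp only [hF, hu]
    rw [← Complex.exp_add, ← map_smul, inner_perpProj]
    congr 1
    rw [← add_mul, ← Complex.ofReal_add, ← Complex.add_re]
    congr 3
    simp only [inner_smul_left, inner_smul_right, inner_sub_right, Complex.conj_I,
      Complex.conj_ofReal]
    ring
  simp_rw [h3] at h2
  calc ∫ q, Real.exp (-(‖u q‖ ^ 2 / 2)) ∂(ν.prod ν)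
      ≤ ‖((∫ q, Real.exp (-(‖u q‖ ^ 2 / 2)) ∂(ν.prod ν) : ℝ) : ℂ)‖ := by
        rw [Complex.norm_real]; exact le_abs_self _
    _ ≤ _ := by
        rw [h2]
        refine (norm_integral_le_integral_norm _).trans_eq ?_
        simp_rw [norm_mul]

/-- The shift `v` contributes only a factor of modulus one; independence factors the rest. -/
lemma norm_rowCharFun_map {Ω : Type*} [MeasurableSpace Ω] {μ : Measure Ω}
    {x : Fin n → Ω → ℂ} (hx : ∀ j, Measurable (x j)) (hind : iIndepFun x μ)
    {ρ : Measure ℂ} (hρ : ∀ j, μ.map (x j) = ρ) (v : Fin n → ℂ) (g : EuclideanSpace ℂ (Fin n)) :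
    ‖rowCharFun (μ.map fun ω => WithLp.toLp 2 fun j => x j ω + v j) g‖
      = ∏ j, ‖charFun ρ (g j)‖ := by
  have hm : Measurable fun ω => (WithLp.toLp 2 fun j => x j ω + v j : EuclideanSpace ℂ (Fin n)) := by
    fun_prop
  have hpt : ∀ ω, Complex.exp
      ((inner ℂ g (WithLp.toLp 2 fun j => x j ω + v j : EuclideanSpace ℂ (Fin n))).re * Complex.I)
      = (∏ j, Complex.exp ((inner ℝ (v j) (g j) : ℝ) * Complex.I))
        * ∏ j, Complex.exp ((inner ℝ (x j ω) (g j) : ℝ) * Complex.I) := by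
    intro ω
    rw [← Complex.exp_sum, ← Complex.exp_sum, ← Complex.exp_add, ← Finset.sum_mul,
      ← Finset.sum_mul, ← add_mul, ← Complex.ofReal_sum, ← Complex.ofReal_sum,
      ← Complex.ofReal_add, ← Finset.sum_add_distrib, PiLp.inner_apply, Complex.re_sum]
    congr 3
    refine Finset.sum_congr rfl fun j _ => ?_
    rw [← inner_add_left, add_comm (v j), real_inner_comm]
    rfl
  rw [rowCharFun, integral_map hm.aemeasurable (by fun_prop)]
  simp_rw [hpt]
  rw [integral_const_mul, norm_mul, norm_prod]
  simp_rw [Complex.norm_exp_ofReal_mul_I]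
  rw [Finset.prod_const_one, one_mul,
    hind.integral_fun_prod_comp (f := fun j y => Complex.exp ((inner ℝ y (g j) : ℝ) * Complex.I))
      (fun j => (hx j).aemeasurable) (fun j => by fun_prop), norm_prod]
  refine Finset.prod_congr rfl fun j _ => ?_
  rw [charFun_apply, ← hρ j, integral_map (hx j).aemeasurable (by fun_prop)]

lemma continuous_rowCharFun (ν : Measure (EuclideanSpace ℂ (Fin n))) [IsProbabilityMeasure ν] :
    Continuous (rowCharFun ν) := by
  unfold rowCharFun
  refine continuous_of_dominated (bound := fun _ => 1) (fun g => by fun_prop)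
    (fun g => ae_of_all _ fun x => (Complex.norm_exp_ofReal_mul_I _).le) (integrable_const _)
    (ae_of_all _ fun x => by fun_prop)

lemma norm_rowCharFun_le_one (ν : Measure (EuclideanSpace ℂ (Fin n))) [IsProbabilityMeasure ν]
    (g : EuclideanSpace ℂ (Fin n)) : ‖rowCharFun ν g‖ ≤ 1 := by
  refine (norm_integral_le_of_norm_le_const (C := 1)
    (ae_of_all _ fun x => (Complex.norm_exp_ofReal_mul_I _).le)).trans_eq ?_
  simp

/-- Small ball estimate for the projection of a row with independent heavy-tailed entries, at
scale `r` and with truncation level `M` for the dual Gaussian vector. -/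
lemma exists_sq_measure_norm_perpProj_le {α c₀ : ℝ} (hα : 0 < α) (hc₀ : 0 < c₀) (ρ : Measure ℂ)
    [IsProbabilityMeasure ρ]
    (hf : (fun t : ℝ => ρ.real {x | t ≤ ‖x‖}) ~[atTop] fun t => c₀ * t ^ (-α)) :
    ∃ c L₀ : ℝ, 0 < c ∧ 0 < L₀ ∧ ∀ p : ℕ, ∃ C : ℝ, 0 < C ∧ ∀ (n : ℕ)
      (W : Submodule ℂ (EuclideanSpace ℂ (Fin n)))
      (ν : Measure (EuclideanSpace ℂ (Fin n))) [IsProbabilityMeasure ν],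
      (∀ g, ‖rowCharFun ν g‖ = ∏ j, ‖charFun ρ (g j)‖) → 0 < Module.finrank ℂ Wᗮ →
      ∀ r M : ℝ, 0 < r → 0 < M → L₀ * M ≤ r →
      (ν.real {x | ‖perpProj W x‖ ≤ r}) ^ 2
        ≤ Real.exp 2 * (C * M⁻¹ ^ (2 * p) + Real.exp (-((Module.finrank ℂ Wᗮ : ℝ) / 4))
          + Real.exp (-(c * (Module.finrank ℂ Wᗮ : ℝ) * (r⁻¹ ^ 2 * (r / M) ^ (2 - α))))) := by
  obtain ⟨c, L₀, hc, hL₀, hdecay⟩ := exists_norm_charFun_mul_le hα hc₀ ρ hf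
  refine ⟨c / 4, L₀, by positivity, hL₀, fun p => ?_⟩
  obtain ⟨C, hC, htrunc⟩ := exists_stdGaussian_truncated_energy p
  refine ⟨C, hC, ?_⟩
  intro n W ν _ hν hpos r M hr hM hrM
  refine (sq_measure_norm_perpProj_le W ν hr).trans
    (mul_le_mul_of_nonneg_left ?_ (Real.exp_pos _).le)
  have hbad := htrunc Wᗮ n (perpBasis W) (norm_perpBasis_le W) (sum_norm_perpBasis_sq W)
    (sum_norm_inner_perpBasis_sq W) hpos M hM
  set m : ℝ := (Module.finrank ℂ Wᗮ : ℝ) with hm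
  set B : Set Wᗮ := {G | ∑ j with ‖inner ℂ (perpBasis W j) G‖ ≤ M,
    ‖inner ℂ (perpBasis W j) G‖ ^ 2 < m / 4} with hB
  have hBm : MeasurableSet B := by
    have heq : B = {G | ∑ j, ({G : Wᗮ | ‖inner ℂ (perpBasis W j) G‖ ≤ M}.indicator
        (fun G => ‖inner ℂ (perpBasis W j) G‖ ^ 2) G) < m / 4} := by
      ext G
      simp only [hB, Set.mem_ofPred_eq, Finset.sum_filter, Set.indicator_apply]
    rw [heq]
    refine measurableSet_lt (Finset.measurable_sum _ fun j _ => ?_) measurable_const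
    exact Measurable.indicator (by fun_prop) (measurableSet_le (by fun_prop) measurable_const)
  set ε : ℝ := Real.exp (-(c / 4 * m * (r⁻¹ ^ 2 * (r / M) ^ (2 - α)))) with hε
  set F : Wᗮ → ℝ := fun G =>
    ‖rowCharFun ν (((r⁻¹ : ℝ) : ℂ) • (G : EuclideanSpace ℂ (Fin n)))‖
      * ‖rowCharFun ν (Complex.I • ((r⁻¹ : ℝ) : ℂ) • (G : EuclideanSpace ℂ (Fin n)))‖ with hF
  have hF1 : ∀ G, F G ≤ 1 := fun G =>
    mul_le_one₀ (norm_rowCharFun_le_one ν _) (norm_nonneg _) (norm_rowCharFun_le_one ν _)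
  have hFc : Continuous F := by
    have := continuous_rowCharFun ν
    fun_prop
  have hFint : Integrable F (stdGaussian Wᗮ) := by
    refine Integrable.of_bound (C := 1) hFc.aestronglyMeasurable (ae_of_all _ fun G => ?_)
    rw [Real.norm_eq_abs, abs_of_nonneg (by positivity)]
    exact hF1 G
  -- Coordinates above M are discarded, their factors being at most 1. For the others the decay
  -- bound applies with L = r/M, and their energy is at least m/4 off `B`.
  have hgood : ∀ G, G ∉ B → F G ≤ ε := by
    intro G hG
    have hG' : m / 4 ≤ ∑ j with ‖inner ℂ (perpBasis W j) G‖ ≤ M,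
        ‖inner ℂ (perpBasis W j) G‖ ^ 2 := not_lt.1 hG
    simp_rw [norm_inner_perpBasis] at hG'
    set g : Fin n → ℂ := fun j => (G : EuclideanSpace ℂ (Fin n)) j with hg
    have hFG : F G = ∏ j, (‖charFun ρ (((r⁻¹ : ℝ) : ℂ) * g j)‖
        * ‖charFun ρ (Complex.I * (((r⁻¹ : ℝ) : ℂ) * g j))‖) := by
      simp only [hF, hν, Finset.prod_mul_distrib]
      rfl
    have hnn : ∀ j, 0 ≤ ‖charFun ρ (((r⁻¹ : ℝ) : ℂ) * g j)‖
        * ‖charFun ρ (Complex.I * (((r⁻¹ : ℝ) : ℂ) * g j))‖ := fun j => by positivity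
    have hle1 : ∀ j, ‖charFun ρ (((r⁻¹ : ℝ) : ℂ) * g j)‖
        * ‖charFun ρ (Complex.I * (((r⁻¹ : ℝ) : ℂ) * g j))‖ ≤ 1 := fun j =>
      mul_le_one₀ (norm_charFun_le_one _) (norm_nonneg _) (norm_charFun_le_one _)
    have hnorm : ∀ j, ‖((r⁻¹ : ℝ) : ℂ) * g j‖ = r⁻¹ * ‖g j‖ := fun j => by
      rw [norm_mul, Complex.norm_real, Real.norm_eq_abs, abs_of_pos (inv_pos.2 hr)]
    calc F G = _ := hFG
      _ ≤ ∏ j with ‖g j‖ ≤ M, (‖charFun ρ (((r⁻¹ : ℝ) : ℂ) * g j)‖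
          * ‖charFun ρ (Complex.I * (((r⁻¹ : ℝ) : ℂ) * g j))‖) := by
          rw [← Finset.prod_filter_mul_prod_filter_not Finset.univ (fun j => ‖g j‖ ≤ M)]
          exact mul_le_of_le_one_right (Finset.prod_nonneg fun j _ => hnn j)
            (Finset.prod_le_one (fun j _ => hnn j) fun j _ => hle1 j)
      _ ≤ ∏ j with ‖g j‖ ≤ M, Real.exp (-(c * (r⁻¹ * ‖g j‖) ^ 2 * (r / M) ^ (2 - α))) := by
          refine Finset.prod_le_prod (fun j _ => hnn j) fun j hj => ?_
          simp only [Finset.mem_filter, Finset.mem_univ, true_and] at hj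
          rw [← hnorm]
          refine hdecay (r / M) ((le_div_iff₀ hM).2 hrM) _ ?_
          rw [hnorm]
          calc r⁻¹ * ‖g j‖ * (r / M) ≤ r⁻¹ * M * (r / M) := by gcongr
            _ = 1 := by field_simp
      _ = Real.exp (-(c * (r⁻¹ ^ 2 * (r / M) ^ (2 - α)) * ∑ j with ‖g j‖ ≤ M, ‖g j‖ ^ 2)) := by
          rw [← Real.exp_sum, Finset.sum_neg_distrib, Finset.mul_sum]
          congr 2
          refine Finset.sum_congr rfl fun j _ => ?_
          ring
      _ ≤ ε := by
          rw [hε]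
          refine Real.exp_le_exp.2 (neg_le_neg ?_)
          calc c / 4 * m * (r⁻¹ ^ 2 * (r / M) ^ (2 - α))
              = c * (r⁻¹ ^ 2 * (r / M) ^ (2 - α)) * (m / 4) := by ring
            _ ≤ _ := by gcongr
  calc ∫ G, F G ∂(stdGaussian Wᗮ)
      ≤ ∫ G, (B.indicator (fun _ => (1 : ℝ)) G + ε) ∂(stdGaussian Wᗮ) := by
        refine integral_mono hFint
          (((integrable_const _).indicator hBm).add (integrable_const _)) fun G => ?_
        by_cases hG : G ∈ B
        · simp only [Set.indicator_of_mem hG]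
          linarith [hF1 G, Real.exp_pos (-(c / 4 * m * (r⁻¹ ^ 2 * (r / M) ^ (2 - α))))]
        · simp only [Set.indicator_of_notMem hG, zero_add]
          exact hgood G hG
    _ = (stdGaussian Wᗮ).real B + ε := by
        rw [integral_add ((integrable_const _).indicator hBm) (integrable_const _),
          integral_indicator_const _ hBm]
        simp
    _ ≤ _ := by gcongr

end SmallBall

lemma exp_neg_le_factorial_div_pow {x : ℝ} (hx : 0 < x) (k : ℕ) :
    Real.exp (-x) ≤ k.factorial / x ^ k := by
  rw [Real.exp_neg, inv_eq_one_div, div_le_div_iff₀ (Real.exp_pos _) (by positivity), one_mul]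
  have h := Real.pow_div_factorial_le_exp x hx.le k
  rwa [div_le_iff₀ (by positivity), mul_comm] at h

/-- Polynomial small ball estimate, to any order, at the natural scale `m ^ (1 / α)` for a
projection of rank `m`. -/
lemma exists_measure_norm_perpProj_le {α c₀ γ : ℝ} (hα : 0 < α) (hα2 : α < 2) (hc₀ : 0 < c₀)
    (hγ : γ ≤ α / 4) (ρ : Measure ℂ) [IsProbabilityMeasure ρ]
    (hf : (fun t : ℝ => ρ.real {x | t ≤ ‖x‖}) ~[atTop] fun t => c₀ * t ^ (-α)) (q : ℕ) :
    ∃ C : ℝ, 0 < C ∧ ∃ N : ℕ, ∀ n : ℕ, N ≤ n → 0 < n →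
      ∀ (W : Submodule ℂ (EuclideanSpace ℂ (Fin n)))
      (ν : Measure (EuclideanSpace ℂ (Fin n))) [IsProbabilityMeasure ν],
      (∀ g, ‖rowCharFun ν g‖ = ∏ j, ‖charFun ρ (g j)‖) →
      (n : ℝ) ^ (1 - γ) ≤ (Module.finrank ℂ Wᗮ : ℝ) →
      ∀ t : ℝ, (n : ℝ) ^ (-(1 / 12) : ℝ) ≤ t → t ≤ 1 →
      ν.real {x | ‖perpProj W x‖ ≤ t * (Module.finrank ℂ Wᗮ : ℝ) ^ (1 / α)} ≤ C * t ^ q := by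
  obtain ⟨c, L₀, hc, hL₀, h⟩ := exists_sq_measure_norm_perpProj_le hα hc₀ ρ hf
  -- The Fourier bound controls the square of the probability, so each error must be O(t^(2q)). Both
  -- M^(-2p) and the p-th order bound on exp(-c t^(-α/2)) give t^(αp/2).
  obtain ⟨p, hp⟩ := exists_nat_ge (4 * q / α)
  rw [div_le_iff₀ hα] at hp
  obtain ⟨C₁, hC₁, hmain⟩ := h p
  set D : ℝ := Real.exp 2 * (C₁ + q.factorial * 4 ^ q + p.factorial / c ^ p) with hD
  have hDpos : 0 < D := by positivity
  obtain ⟨N, hN⟩ := exists_nat_ge (L₀ ^ 8)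
  refine ⟨√D, Real.sqrt_pos.2 hDpos, N, ?_⟩
  intro n hNn hn W ν _ hν hm t ht ht1
  set m : ℝ := (Module.finrank ℂ Wᗮ : ℝ) with hmdef
  have hn1 : (1:ℝ) ≤ n := by exact_mod_cast hn
  have hn0 : (0:ℝ) < n := by linarith
  have ht0 : 0 < t := lt_of_lt_of_le (Real.rpow_pos_of_pos hn0 _) ht
  have hmpos : 0 < m := lt_of_lt_of_le (Real.rpow_pos_of_pos hn0 _) hm
  -- Since γ ≤ α/4 < 1/2, the codimension is at least √n.
  have hγ2 : 1 / 2 ≤ 1 - γ := by linarith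
  have hmhalf : (n : ℝ) ^ (1 / 2 : ℝ) ≤ m :=
    (Real.rpow_le_rpow_of_exponent_le hn1 hγ2).trans hm
  set r : ℝ := t * m ^ (1 / α) with hr
  set M : ℝ := t ^ (-(α / 4)) with hM
  have hrpos : 0 < r := by positivity
  have hMpos : 0 < M := by positivity
  -- Here r/M = t^(1+α/4) m^(1/α), with 1 + α/4 < 3/2 and m^(1/α) ≥ n^(1/4). The cutoff t ≥
  -- n^(-1/12) makes the first factor at least n^(-1/8), leaving n^(1/8) ≥ L₀.
  have hcond : L₀ * M ≤ r := by
    have h1 : L₀ ≤ (n : ℝ) ^ (1 / 8 : ℝ) := by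
      have h2 : L₀ ^ 8 ≤ n := hN.trans (by exact_mod_cast hNn)
      calc L₀ = (L₀ ^ 8) ^ (1 / 8 : ℝ) := by
            rw [← Real.rpow_natCast, ← Real.rpow_mul hL₀.le]; norm_num
        _ ≤ _ := Real.rpow_le_rpow (by positivity) h2 (by norm_num)
    have h2 : (n : ℝ) ^ (-(1 / 8) : ℝ) ≤ t ^ (1 + α / 4) := by
      calc (n : ℝ) ^ (-(1 / 8) : ℝ) ≤ (n : ℝ) ^ (-(1 / 12) * (1 + α / 4) : ℝ) :=
            Real.rpow_le_rpow_of_exponent_le hn1 (by linarith)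
        _ = ((n : ℝ) ^ (-(1 / 12) : ℝ)) ^ (1 + α / 4) := by rw [← Real.rpow_mul hn0.le]
        _ ≤ _ := Real.rpow_le_rpow (by positivity) ht (by positivity)
    have h3 : (n : ℝ) ^ (1 / 4 : ℝ) ≤ m ^ (1 / α) := by
      calc (n : ℝ) ^ (1 / 4 : ℝ) ≤ (n : ℝ) ^ ((1 / 2) * (1 / α) : ℝ) := by
            refine Real.rpow_le_rpow_of_exponent_le hn1 ?_
            have : (1:ℝ) / 2 ≤ 1 / α := one_div_le_one_div_of_le hα hα2.le
            linarith
        _ = ((n : ℝ) ^ (1 / 2 : ℝ)) ^ (1 / α) := by rw [← Real.rpow_mul hn0.le]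
        _ ≤ _ := Real.rpow_le_rpow (by positivity) hmhalf (by positivity)
    have h4 : r = M * (t ^ (1 + α / 4) * m ^ (1 / α)) := by
      rw [hr, hM, ← mul_assoc, ← Real.rpow_add ht0]
      simp
    rw [h4, mul_comm]
    refine mul_le_mul_of_nonneg_left ?_ hMpos.le
    calc L₀ ≤ (n : ℝ) ^ (1 / 8 : ℝ) := h1
      _ = (n : ℝ) ^ (-(1 / 8) : ℝ) * (n : ℝ) ^ (1 / 4 : ℝ) := by
          rw [← Real.rpow_add hn0]; norm_num
      _ ≤ _ := by gcongr
  have hb := hmain n W ν hν (Nat.cast_pos.1 hmpos) r M hrpos hMpos hcond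
  have htq : ∀ e : ℝ, 2 * q ≤ e → t ^ e ≤ (t ^ q) ^ 2 := fun e he => by
    rw [← pow_mul, ← Real.rpow_natCast]
    refine Real.rpow_le_rpow_of_exponent_ge ht0 ht1 ?_
    push_cast
    linarith
  have hb1 : C₁ * M⁻¹ ^ (2 * p) ≤ C₁ * (t ^ q) ^ 2 := by
    refine mul_le_mul_of_nonneg_left ?_ hC₁.le
    have : M⁻¹ ^ (2 * p) = t ^ (α / 4 * (2 * p)) := by
      rw [hM, ← Real.rpow_neg ht0.le, neg_neg, ← Real.rpow_natCast, ← Real.rpow_mul ht0.le]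
      push_cast
      rfl
    rw [this]
    exact htq _ (by linarith)
  have hb2 : Real.exp (-(m / 4)) ≤ q.factorial * 4 ^ q * (t ^ q) ^ 2 := by
    refine (exp_neg_le_factorial_div_pow (by positivity) q).trans ?_
    rw [div_pow, div_div_eq_mul_div, div_eq_mul_inv, ← inv_pow, pow_right_comm t q 2]
    refine mul_le_mul_of_nonneg_left (pow_le_pow_left₀ (by positivity) ?_ q) (by positivity)
    calc m⁻¹ ≤ ((n : ℝ) ^ (1 / 2 : ℝ))⁻¹ := inv_anti₀ (by positivity) hmhalf
      _ = (n : ℝ) ^ (-(1 / 2) : ℝ) := by rw [Real.rpow_neg hn0.le]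
      _ ≤ (n : ℝ) ^ (-(1 / 12) * (2 : ℕ) : ℝ) :=
          Real.rpow_le_rpow_of_exponent_le hn1 (by norm_num)
      _ = ((n : ℝ) ^ (-(1 / 12) : ℝ)) ^ 2 := by
          rw [Real.rpow_mul hn0.le, Real.rpow_natCast]
      _ ≤ t ^ 2 := by gcongr
  have hb3 : Real.exp (-(c * m * (r⁻¹ ^ 2 * (r / M) ^ (2 - α))))
      ≤ p.factorial / c ^ p * (t ^ q) ^ 2 := by
    -- By the choice of r the powers of m cancel, leaving exactly t^(-α + (α/4)(2-α)): truncating at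
    -- M costs less than half of the exponent α.
    have h1 : t ^ (-(α / 2)) ≤ m * (r⁻¹ ^ 2 * (r / M) ^ (2 - α)) := by
      have h2 : r ^ α = t ^ α * m := by
        rw [hr, Real.mul_rpow ht0.le (by positivity), ← Real.rpow_mul hmpos.le,
          one_div_mul_cancel hα.ne', Real.rpow_one]
      have h3 : (r / M) ^ (2 - α) = r ^ 2 * (r ^ α)⁻¹ * t ^ (α / 4 * (2 - α)) := by
        rw [Real.div_rpow hrpos.le hMpos.le, Real.rpow_sub hrpos, Real.rpow_two, hM,
          ← Real.rpow_mul ht0.le, div_eq_mul_inv, div_eq_mul_inv, ← Real.rpow_neg ht0.le]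
        congr 2
        ring
      have h4 : m * (r⁻¹ ^ 2 * (r / M) ^ (2 - α)) = t ^ (-α + α / 4 * (2 - α)) := by
        rw [h3, h2, Real.rpow_add ht0, Real.rpow_neg ht0.le]
        field_simp
      rw [h4]
      exact Real.rpow_le_rpow_of_exponent_ge ht0 ht1 (by nlinarith)
    have h5 : Real.exp (-(c * m * (r⁻¹ ^ 2 * (r / M) ^ (2 - α))))
        ≤ Real.exp (-(c * t ^ (-(α / 2)))) := by
      refine Real.exp_le_exp.2 (neg_le_neg ?_)
      rw [mul_assoc]
      gcongr
    refine h5.trans ((exp_neg_le_factorial_div_pow (by positivity) p).trans ?_)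
    rw [mul_pow, ← div_div, div_eq_mul_inv _ ((t ^ (-(α / 2))) ^ p)]
    refine mul_le_mul_of_nonneg_left ?_ (by positivity)
    rw [← inv_pow, ← Real.rpow_neg ht0.le, neg_neg, ← Real.rpow_natCast, ← Real.rpow_mul ht0.le]
    exact htq _ (by linarith)
  refine le_of_sq_le_sq ?_ (by positivity)
  calc _ ≤ _ := hb
    _ ≤ Real.exp 2 * (C₁ * (t ^ q) ^ 2 + q.factorial * 4 ^ q * (t ^ q) ^ 2
        + p.factorial / c ^ p * (t ^ q) ^ 2) := by gcongr
    _ = D * (t ^ q) ^ 2 := by rw [hD]; ring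
    _ = (√D * t ^ q) ^ 2 := by rw [mul_pow, Real.sq_sqrt hDpos.le]

/-! ### From small balls to the inverse second moment. -/

/-- If y first falls below the scale s/2^k but not below s/2^(k+1), then 1/y² is less than
4^(k+1)/s², which is one term of the sum. -/
lemma inv_sq_le_dyadic {y s : ℝ} (hs : 0 < s) (K : ℕ) (hy : (1 / 2) ^ K * s < y) :
    (y ^ 2)⁻¹ ≤ (s ^ 2)⁻¹ * (1 + ∑ k ∈ Finset.range K,
      4 ^ (k + 1) * (Set.Iic ((1 / 2) ^ k * s)).indicator (fun _ => (1:ℝ)) y) := by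
  have hnn : ∀ K : ℕ, 0 ≤ ∑ k ∈ Finset.range K,
      4 ^ (k + 1) * (Set.Iic ((1 / 2) ^ k * s)).indicator (fun _ => (1:ℝ)) y := fun K =>
    Finset.sum_nonneg fun k _ =>
      mul_nonneg (by positivity) (Set.indicator_nonneg (fun _ _ => zero_le_one) _)
  induction K with
  | zero =>
    simp only [pow_zero, one_mul] at hy
    simp only [Finset.range_zero, Finset.sum_empty, add_zero, mul_one]
    exact inv_anti₀ (by positivity) (by gcongr)
  | succ K ih =>
    rw [Finset.sum_range_succ]
    have hs2 : 0 < (s ^ 2)⁻¹ := by positivity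
    by_cases h : (1 / 2) ^ K * s < y
    · refine (ih h).trans (mul_le_mul_of_nonneg_left ?_ hs2.le)
      have : 0 ≤ 4 ^ (K + 1) * (Set.Iic ((1 / 2) ^ K * s)).indicator (fun _ => (1:ℝ)) y :=
        mul_nonneg (by positivity) (Set.indicator_nonneg (fun _ _ => zero_le_one) _)
      linarith
    · rw [Set.indicator_of_mem (show y ∈ Set.Iic ((1 / 2) ^ K * s) from not_lt.1 h), mul_one]
      have h1 : (y ^ 2)⁻¹ ≤ (((1 / 2) ^ (K + 1) * s) ^ 2)⁻¹ :=
        inv_anti₀ (by positivity) (by gcongr)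
      have h2 : (((1 / 2 : ℝ) ^ (K + 1) * s) ^ 2)⁻¹ = (s ^ 2)⁻¹ * 4 ^ (K + 1) := by
        rw [mul_pow, mul_inv, ← pow_mul, mul_comm (K + 1) 2, pow_mul, ← inv_pow, mul_comm]
        norm_num
      rw [h2] at h1
      refine h1.trans (mul_le_mul_of_nonneg_left ?_ hs2.le)
      linarith [hnn K]

/-- Control of an inverse second moment by small ball probabilities at dyadic scales. -/
lemma setLIntegral_inv_sq_le {Ω : Type*} [MeasurableSpace Ω] {μ : Measure Ω}
    [IsProbabilityMeasure μ] {Y : Ω → ℝ} (hY : Measurable Y) {s C : ℝ} (hs : 0 < s) (hC : 0 ≤ C)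
    (K : ℕ) (h : ∀ k ≤ K, μ.real {ω | Y ω ≤ (1 / 2) ^ k * s} ≤ C * ((1 / 2) ^ k) ^ 4) :
    ∫⁻ ω in {ω | (1 / 2) ^ K * s < Y ω}, (ENNReal.ofReal (Y ω) ^ 2)⁻¹ ∂μ
      ≤ ENNReal.ofReal ((1 + 8 * C) * (s ^ 2)⁻¹) := by
  set f : Ω → ℝ := fun ω => (s ^ 2)⁻¹ * (1 + ∑ k ∈ Finset.range K,
      4 ^ (k + 1) * {ω | Y ω ≤ (1 / 2) ^ k * s}.indicator (fun _ => (1:ℝ)) ω) with hf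
  have hYm : ∀ a : ℝ, MeasurableSet {ω | Y ω ≤ a} := fun a => measurableSet_le hY measurable_const
  have hind : ∀ k, Integrable (fun ω => 4 ^ (k + 1)
      * {ω | Y ω ≤ (1 / 2) ^ k * s}.indicator (fun _ => (1:ℝ)) ω) μ := fun k =>
    ((integrable_const _).indicator (hYm _)).const_mul _
  have hfint : Integrable f μ :=
    ((integrable_const _).add (integrable_finsetSum _ fun k _ => hind k)).const_mul _
  have hf0 : ∀ ω, 0 ≤ f ω := fun ω =>
    mul_nonneg (by positivity) (add_nonneg zero_le_one (Finset.sum_nonneg fun k _ =>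
      mul_nonneg (by positivity) (Set.indicator_nonneg (fun _ _ => zero_le_one) _)))
  have hsum : ∑ k ∈ Finset.range K, ((1 / 4 : ℝ)) ^ k ≤ 2 := by
    have h1 : (0:ℝ) ≤ (1 / 4) ^ K := by positivity
    have h2 := geom_sum_mul (1 / 4 : ℝ) K
    linarith
  calc ∫⁻ ω in {ω | (1 / 2) ^ K * s < Y ω}, (ENNReal.ofReal (Y ω) ^ 2)⁻¹ ∂μ
      ≤ ∫⁻ ω in {ω | (1 / 2) ^ K * s < Y ω}, ENNReal.ofReal (f ω) ∂μ := by
        refine setLIntegral_mono' (measurableSet_lt measurable_const hY) fun ω hω => ?_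
        have hω : (1 / 2) ^ K * s < Y ω := hω
        have hpos : 0 < Y ω := lt_trans (by positivity) hω
        rw [← ENNReal.ofReal_pow hpos.le, ← ENNReal.ofReal_inv_of_pos (by positivity)]
        exact ENNReal.ofReal_le_ofReal (inv_sq_le_dyadic hs K hω)
    _ ≤ ∫⁻ ω, ENNReal.ofReal (f ω) ∂μ := setLIntegral_le_lintegral _ _
    _ = ENNReal.ofReal (∫ ω, f ω ∂μ) :=
        (ofReal_integral_eq_lintegral_ofReal hfint (ae_of_all _ hf0)).symm
    _ ≤ _ := by
        refine ENNReal.ofReal_le_ofReal ?_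
        rw [hf, integral_const_mul, integral_add (integrable_const _)
          (integrable_finsetSum _ fun k _ => hind k), integral_finsetSum _ fun k _ => hind k]
        simp_rw [integral_const_mul, integral_indicator_const _ (hYm _)]
        rw [mul_comm]
        refine mul_le_mul_of_nonneg_right ?_ (by positivity)
        simp only [integral_const, probReal_univ, smul_eq_mul, mul_one]
        -- Small ball exponent 4 beats the weight 4^k and leaves a geometric series of ratio 1/4.
        have h1 : ∑ k ∈ Finset.range K, 4 ^ (k + 1) * μ.real {ω | Y ω ≤ (1 / 2) ^ k * s}
            ≤ ∑ k ∈ Finset.range K, 4 * C * (1 / 4) ^ k := by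
          refine Finset.sum_le_sum fun k hk => ?_
          calc _ ≤ 4 ^ (k + 1) * (C * ((1 / 2) ^ k) ^ 4) := by
                gcongr
                exact h k (Finset.mem_range.1 hk).le
            _ = _ := by
                rw [← pow_mul, mul_comm k 4, pow_mul, pow_succ]
                have : (4:ℝ) ^ k * ((1 / 2) ^ 4) ^ k = (1 / 4) ^ k := by
                  rw [← mul_pow]; norm_num
                linear_combination 4 * C * this
        rw [← Finset.mul_sum] at h1
        nlinarith

/-! ### The first row as a shifted independent vector. -/

/-- The tail is positive at some a₀ > 0, so for large n every admissible a is at least a₀.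
Admissible values exist because the tail tends to 0; this matters since `sInf` of the empty set is
0. -/
lemma eventually_scale_ne_zero {Ω : Type*} [MeasurableSpace Ω] {μ : Measure Ω}
    [IsProbabilityMeasure μ] {Y : Ω → ℂ} {α : ℝ} (hα : 0 < α) (h : PowerTail μ Y α) :
    ∃ N : ℕ, ∀ n, N ≤ n → scale μ Y n ≠ 0 := by
  obtain ⟨c₀, hc₀, hf⟩ := h
  obtain ⟨a₀, ha₀, ha₀pos⟩ :=
    ((eventually_tail_bounds hc₀ hf).and (eventually_gt_atTop 0)).exists
  have hpos : 0 < μ.real {ω | a₀ ≤ ‖Y ω‖} :=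
    lt_of_lt_of_le (mul_pos (by positivity) (Real.rpow_pos_of_pos ha₀pos _)) ha₀.1
  obtain ⟨N, hN⟩ := exists_nat_gt (1 / μ.real {ω | a₀ ≤ ‖Y ω‖})
  rw [div_lt_iff₀ hpos] at hN
  refine ⟨N, fun n hn => (lt_of_lt_of_le ha₀pos (le_csInf ?_ ?_)).ne'⟩
  · have hev := (tendsto_tail_zero hα hf).eventually_lt_const
      (show (0:ℝ) < 1 / (n + 1) by positivity)
    obtain ⟨a, ha, hapos⟩ := (hev.and (eventually_gt_atTop 0)).exists
    refine ⟨a, hapos, ?_⟩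
    rw [lt_div_iff₀ (by positivity)] at ha
    have : 0 ≤ μ.real {ω | a ≤ ‖Y ω‖} := measureReal_nonneg
    nlinarith
  · rintro a ⟨_, ha⟩
    by_contra! hlt
    have h1 : μ.real {ω | a₀ ≤ ‖Y ω‖} ≤ μ.real {ω | a ≤ ‖Y ω‖} :=
      measureReal_mono fun ω hω => hlt.le.trans hω
    have h2 : (N : ℝ) ≤ n := by exact_mod_cast hn
    have h3 : (N : ℝ) * μ.real {ω | a₀ ≤ ‖Y ω‖} ≤ n * μ.real {ω | a ≤ ‖Y ω‖} := by gcongr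
    linarith

lemma firstRow_eq {Ω : Type*} [MeasurableSpace Ω] {μ : Measure Ω} {X : ℕ → ℕ → Ω → ℂ} (z : ℂ)
    {n : ℕ} (hn : 0 < n) (hs : scale μ (X 0 0) n ≠ 0) :
    ∃ v : Fin n → ℂ, firstRow μ X z n hn
      = fun ω => WithLp.toLp 2 fun j : Fin n => X 0 j ω + v j := by
  have hs' : ((scale μ (X 0 0) n : ℝ) : ℂ) ≠ 0 := by exact_mod_cast hs
  refine ⟨fun j => -(((scale μ (X 0 0) n : ℝ) : ℂ)
    * (z * (1 : Matrix (Fin n) (Fin n) ℂ) ⟨0, hn⟩ j)), ?_⟩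
  ext ω j
  simp only [firstRow, rescaledMatrix, Matrix.row, Matrix.smul_apply, Matrix.sub_apply,
    Matrix.of_apply, smul_eq_mul]
  rw [mul_sub, mul_inv_cancel_left₀ hs', sub_eq_add_neg]

end HeavyTailed

/-! ### Choice of the event and conclusion. -/

theorem proposition3p6 {Ω : Type*} [MeasurableSpace Ω] (μ : Measure Ω) [IsProbabilityMeasure μ]
    (X : ℕ → ℕ → Ω → ℂ) (hX : HeavyTailed.IsIIDArray μ X)
    (α : ℝ) (hα0 : 0 < α) (hα2 : α < 2) (hH2 : HeavyTailed.PowerTail μ (X 0 0) α)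
    (γ : ℝ) (hγ0 : 0 < γ) (hγ : γ ≤ α / 4) (z : ℂ) :
    ∃ c : ℝ, 0 < c ∧ ∀ (n : ℕ) (hn : 0 < n) (W : Submodule ℂ (EuclideanSpace ℂ (Fin n))),
      (n : ℝ) ^ (1 - γ) ≤ (n : ℝ) - (Module.finrank ℂ W : ℝ) →
      ∃ E : Set Ω,
        MeasurableSet[MeasurableSpace.comap (HeavyTailed.firstRow μ X z n hn) inferInstance] E ∧
        ∫⁻ ω in E, ((Metric.infEDist (HeavyTailed.firstRow μ X z n hn ω)
            (W : Set (EuclideanSpace ℂ (Fin n)))) ^ 2)⁻¹ ∂μ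
          ≤ ENNReal.ofReal (c * ((n : ℝ) - (Module.finrank ℂ W : ℝ)) ^ (-(2 / α))) ∧
        μ.real Eᶜ ≤ c * (n : ℝ) ^ (-((1 - 2 * γ) / α)) := by
  obtain ⟨N₁, hN₁⟩ := HeavyTailed.eventually_scale_ne_zero hα0 hH2
  obtain ⟨c₀, hc₀, hf⟩ := hH2
  set ρ : Measure ℂ := μ.map (X 0 0) with hρ
  have : IsProbabilityMeasure ρ :=
    Measure.isProbabilityMeasure_map (hX.measurable 0 0).aemeasurable
  have hfρ : (fun t : ℝ => ρ.real {x | t ≤ ‖x‖}) ~[atTop] fun t => c₀ * t ^ (-α) := by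
    convert hf using 2 with t
    rw [hρ, map_measureReal_apply (hX.measurable 0 0)
      (measurableSet_le measurable_const measurable_norm)]
    rfl
  -- Exponent 4 serves the dyadic sum; 12/α makes the smallest ball, of relative radius about
  -- n^(-1/12), have probability O(n^(-1/α)).
  obtain ⟨q, hq⟩ := exists_nat_ge (max 4 (12 / α))
  have hq4 : 4 ≤ q := by exact_mod_cast (le_max_left _ _).trans hq
  have hqα : 12 / α ≤ q := (le_max_right _ _).trans hq
  obtain ⟨C, hC, N₂, hsmall⟩ :=
    HeavyTailed.exists_measure_norm_perpProj_le hα0 hα2 hc₀ hγ ρ hfρ q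
  set N : ℕ := max N₁ N₂ with hN
  set β : ℝ := (1 - 2 * γ) / α with hβ
  have hβ0 : 0 ≤ β := div_nonneg (by linarith) hα0.le
  -- The three terms pay for the inverse moment, for the complement of the event, and for the
  -- finitely many n < N, where the empty event is used.
  refine ⟨(1 + 8 * C) + C * 2 ^ q + (N : ℝ) ^ β, by positivity, ?_⟩
  intro n hn W hW
  have hn1 : (1:ℝ) ≤ n := by exact_mod_cast hn
  have hn0 : (0:ℝ) < n := by linarith
  have hNβ : 0 ≤ (N : ℝ) ^ β := by positivity
  rcases lt_or_ge n N with hlt | hge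
  · refine ⟨∅, MeasurableSpace.measurableSet_empty _, by simp, ?_⟩
    rw [Set.compl_empty, probReal_univ, Real.rpow_neg hn0.le, ← div_eq_mul_inv,
      le_div_iff₀ (by positivity), one_mul]
    have h1 : (n : ℝ) ^ β ≤ (N : ℝ) ^ β :=
      Real.rpow_le_rpow hn0.le (by exact_mod_cast hlt.le) hβ0
    have h2 : 0 < C * 2 ^ q := by positivity
    linarith
  have hcodim : (n : ℝ) - (Module.finrank ℂ W : ℝ) = (Module.finrank ℂ Wᗮ : ℝ) := by
    have h1 := W.finrank_add_finrank_orthogonal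
    rw [finrank_euclideanSpace_fin] at h1
    have h2 : (Module.finrank ℂ W : ℝ) + (Module.finrank ℂ Wᗮ : ℝ) = n := by exact_mod_cast h1
    linarith
  rw [hcodim] at hW ⊢
  set m : ℝ := (Module.finrank ℂ Wᗮ : ℝ) with hm
  have hmpos : 0 < m := lt_of_lt_of_le (Real.rpow_pos_of_pos hn0 _) hW
  obtain ⟨v, hv⟩ := HeavyTailed.firstRow_eq z hn (hN₁ n ((le_max_left _ _).trans hge))
  set R := HeavyTailed.firstRow μ X z n hn with hR
  have hRm : Measurable R := by
    rw [hv]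
    have hXm := hX.measurable
    fun_prop
  have : IsProbabilityMeasure (μ.map R) := Measure.isProbabilityMeasure_map hRm.aemeasurable
  have hfac : ∀ g, ‖HeavyTailed.rowCharFun (μ.map R) g‖ = ∏ j, ‖charFun ρ (g j)‖ := by
    intro g
    rw [hv]
    exact HeavyTailed.norm_rowCharFun_map (x := fun j : Fin n => X 0 j)
      (fun j => hX.measurable 0 j)
      (hX.indep.precomp (g := fun j : Fin n => ((0 : ℕ), (j : ℕ)))
        fun i j hij => Fin.ext (by simpa using hij))
      (fun j => (hX.identDistrib 0 j).map_eq) v g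
  set Y : Ω → ℝ := fun ω => ‖HeavyTailed.perpProj W (R ω)‖ with hY
  have hYm : Measurable Y := by fun_prop
  set s : ℝ := m ^ (1 / α) with hs
  have hspos : 0 < s := Real.rpow_pos_of_pos hmpos _
  have hball : ∀ t : ℝ, (n : ℝ) ^ (-(1 / 12) : ℝ) ≤ t → t ≤ 1 →
      μ.real {ω | Y ω ≤ t * s} ≤ C * t ^ q := by
    intro t ht ht1
    have h1 := hsmall n ((le_max_right _ _).trans hge) hn W (μ.map R) hfac hW t ht ht1
    rwa [map_measureReal_apply hRm (measurableSet_le (by fun_prop) measurable_const)] at h1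
  -- K is the last dyadic index at which the small ball estimate is available: 2^(-K-1) < n^(-1/12)
  -- ≤ 2^(-K).
  obtain ⟨K, hK1, hK2⟩ := exists_nat_pow_near_of_lt_one
    (Real.rpow_pos_of_pos hn0 (-(1 / 12)))
    (Real.rpow_le_one_of_one_le_of_nonpos hn1 (by norm_num))
    (show (0:ℝ) < 1 / 2 by norm_num) (by norm_num)
  have hpow1 : ∀ k : ℕ, ((1 / 2 : ℝ)) ^ k ≤ 1 := fun k =>
    pow_le_one₀ (by norm_num) (by norm_num)
  refine ⟨{ω | (1 / 2) ^ K * s < Y ω}, ?_, ?_, ?_⟩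
  · exact ⟨{x | (1 / 2) ^ K * s < ‖HeavyTailed.perpProj W x‖},
      measurableSet_lt measurable_const (by fun_prop), rfl⟩
  · have hint := HeavyTailed.setLIntegral_inv_sq_le (μ := μ) hYm hspos hC.le K fun k hk => by
      refine (hball _ (hK2.trans (pow_le_pow_of_le_one (by norm_num) (by norm_num) hk))
        (hpow1 k)).trans (mul_le_mul_of_nonneg_left ?_ hC.le)
      exact pow_le_pow_of_le_one (by positivity) (hpow1 k) hq4
    calc _ ≤ ∫⁻ ω in {ω | (1 / 2) ^ K * s < Y ω}, (ENNReal.ofReal (Y ω) ^ 2)⁻¹ ∂μ := by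
          refine lintegral_mono fun ω => ENNReal.inv_le_inv.2 ?_
          gcongr
          exact HeavyTailed.norm_perpProj_le_infEDist W (R ω)
      _ ≤ _ := hint
      _ ≤ _ := by
          refine ENNReal.ofReal_le_ofReal ?_
          have h1 : (s ^ 2)⁻¹ = m ^ (-(2 / α)) := by
            rw [hs, ← Real.rpow_natCast, ← Real.rpow_mul hmpos.le, ← Real.rpow_neg hmpos.le]
            congr 1
            push_cast
            ring
          rw [h1]
          have h2 : 0 < C * 2 ^ q := by positivity
          refine mul_le_mul_of_nonneg_right (by linarith) (by positivity)
  · have hcompl : {ω | (1 / 2) ^ K * s < Y ω}ᶜ = {ω | Y ω ≤ (1 / 2) ^ K * s} := by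
      ext ω; simp
    rw [hcompl]
    calc _ ≤ C * ((1 / 2) ^ K) ^ q := hball _ hK2 (hpow1 K)
      _ ≤ C * (2 * (n : ℝ) ^ (-(1 / 12) : ℝ)) ^ q := by
          have : ((1 / 2 : ℝ)) ^ K ≤ 2 * (n : ℝ) ^ (-(1 / 12) : ℝ) := by
            rw [pow_succ] at hK1
            linarith
          gcongr
      _ = C * 2 ^ q * (n : ℝ) ^ (-(1 / 12) * q : ℝ) := by
          rw [mul_pow, Real.rpow_mul hn0.le, Real.rpow_natCast, mul_assoc]
      _ ≤ C * 2 ^ q * (n : ℝ) ^ (-β) := by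
          have hβq : β ≤ 1 / 12 * q := by
            calc β ≤ 1 / α := by rw [hβ]; gcongr; linarith
              _ = 1 / 12 * (12 / α) := by ring
              _ ≤ _ := by gcongr
          gcongr
          linarith
      _ ≤ _ := by
          refine mul_le_mul_of_nonneg_right (by linarith) (by positivity)
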